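/- Let $R$ be a left noetherian ring, $S$ a right noetherian ring, and ${}_RU$ a generalized tilting module with $S=\mathrm{End}({}_RU)$ acting on the right of $U$; that is, ${}_RU$ is finitely generated and has a resolution $\cdots\to P_1\to P_0\to U\to 0$ by finitely generated projective modules, $\mathrm{Ext}^i_R(U,U)=0$ for all $i\ge 1$, and there is an exact sequence $0\to R\to U_0\to U_1\to\cdots$ that remains exact under $\mathrm{Hom}_R(-,U)$ and in which every $U_i$ is a direct summand of a finite direct sum of copies of $U$. Let $\operatorname{mod} R$ and $\operatorname{mod} S^{op}$ be the categories of finitely generated left $R$-modules and finitely generated right $S$-modules, and let $$0\to {}_RU\to E_0\to E_1\to\cdots$$ be a minimal injective resolution of ${}_RU$. For a positive integer $n$ put - ${}^{\perp_n}_{R}U=\{M\in\operatorname{mod} R \mid \mathrm{Ext}^i_R(M,U)=0 \text{ for } 1\le i\le n\}$, - $\mathcal E_n(U_S)=\{M\in\operatorname{mod} R\mid M\cong \mathrm{Ext}^n_S(N,U)\text{ for some }N\in\operatorname{mod} S^{op}\}$, - $\mathcal H_n({}_RU)=\{M\in\operatorname{mod} R\mid \mathrm{Ext}^i_R(M,U)=0\text{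 for all } i\ge 0 \text{ with } i\ne n\}$, - $\overline{\mathcal H_n({}_RU)}=\{M\in\operatorname{mod} R\mid\text{every non-zero submodule of } M \text{ is in } \mathcal H_n({}_RU)\}$. A class of modules in $\operatorname{mod} R$ is submodule-closed if every non-zero submodule of a module in the class is again in the class. Let $\text{add-lim}\,{}_RU$ be the class of left $R$-modules isomorphic to a direct summand of a direct limit (over a directed set) of finite direct sums of copies of $U$. The $U$-limit dimension $U\text{-}\mathrm{lim.dim}_R(A)$ of a left $R$-module $A$ is the least $m\ge 0$ such that there is an exact sequence $0\to V_m\to\cdots\to V_0\to A\to 0$ with all $V_i\in\text{add-lim}\,{}_RU$, and it is $\infty$ if there is no such $m$. **Theorem 3.7.** Let $n$ be a positive integer. Assume that the injective dimension of ${}_RU$ is at most $n$ and that ${}^{\perp_n}_{R}U$ has the $U$-torsionless property, i.e. for every $M\in{}^{\perp_n}_{R}U$ the evaluation map $M\to\mathrm{Hom}_S(\mathrm{Hom}_R(M,U),U)$ is injective. Then the following are equivalent: 1. $U\text{-}\mathrm{lim.dim}_R\bigl(\bigoplus_{i=0}^{n-1}E_i\bigr)\le n-1$. 2. $\mathcal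 E_n(U_S)$ is submodule-closed and $\mathcal E_n(U_S)=\mathcal H_n({}_RU)$. 3. $\mathcal E_n(U_S)$ is submodule-closed and $\mathcal E_n(U_S)=\overline{\mathcal H_n({}_RU)}$. -/

import Mathlib

open CategoryTheory CategoryTheory.Abelian
open scoped DirectSum

universe u

noncomputable section

/-! ### Left modules over a ring `R`

Throughout, right modules over a ring `S` are modules over `Sᵐᵒᵖ`, and an `(R, S)`-bimodule is an
abelian group with commuting actions of `R` and `Sᵐᵒᵖ`. -/

section LeftModules

variable (R : Type u) [Ring R] (U : Type u) [AddCommGroup U] [Module R U]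

/-- `V` lies in `add U`: it is isomorphic to a direct summand of a finite sum of copies of `U`. -/
def IsInAdd (V : Type u) [AddCommGroup V] [Module R V] : Prop :=
  ∃ (k : ℕ) (i : V →ₗ[R] (Fin k → U)) (p : (Fin k → U) →ₗ[R] V), p ∘ₗ i = LinearMap.id

/-- `V` lies in `add-lim U`: it is isomorphic to a direct summand of a direct limit (over a directed
index set) of finite direct sums of copies of `U`. -/
def IsInAddLim (V : Type u) [AddCommGroup V] [Module R V] : Prop :=
  ∃ (ι : Type u) (_ : Preorder ι) (_ : DecidableEq ι) (_ : Nonempty ι) (_ : IsDirectedOrder ι)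
    (k : ι → ℕ) (f : ∀ i j, i ≤ j → (Fin (k i) → U) →ₗ[R] (Fin (k j) → U))
    (_ : DirectedSystem (fun i => Fin (k i) → U) (fun i j h => f i j h))
    (s : V →ₗ[R] Module.DirectLimit (fun i => Fin (k i) → U) f)
    (p : Module.DirectLimit (fun i => Fin (k i) → U) f →ₗ[R] V), p ∘ₗ s = LinearMap.id

/-- `U ∈ gen*(R)`: there is an exact sequence `⋯ → P₁ → P₀ → U → 0` in which all `Pᵢ` are finitely
generated projective. -/
def IsInGenStar : Prop :=
  ∃ (P : ℕ → ModuleCat.{u} R) (d : ∀ i, P (i + 1) →ₗ[R] P i) (ε : P 0 →ₗ[R] U),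
    (∀ i, Module.Finite R (P i) ∧ Module.Projective R (P i)) ∧
    Function.Surjective ε ∧ Function.Exact (d 0) ε ∧ ∀ i, Function.Exact (d (i + 1)) (d i)

/-- `U` is selforthogonal: `Ext^i_R(U, U) = 0` for all `i ≥ 1`. -/
def IsSelforthogonal : Prop :=
  ∀ i : ℕ, 1 ≤ i → Subsingleton (Ext.{u} (ModuleCat.of R U) (ModuleCat.of R U) i)

/-- `U` is a generalized tilting (Wakamatsu tilting) left `R`-module: it is a selforthogonal module
in `gen*(R)`, and there is an exact sequence `0 → R → U₀ → U₁ → ⋯` with all `Uᵢ` in `add U` that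
remains exact after applying `Hom_R(-, U)`. -/
structure IsGeneralizedTilting : Prop where
  gen : IsInGenStar R U
  selforthogonal : IsSelforthogonal R U
  coresolution : ∃ (X : ℕ → ModuleCat.{u} R) (η : R →ₗ[R] X 0) (d : ∀ i, X i →ₗ[R] X (i + 1)),
    (∀ i, IsInAdd R U (X i)) ∧
    Function.Injective η ∧ Function.Exact η (d 0) ∧ (∀ i, Function.Exact (d i) (d (i + 1))) ∧
    Function.Surjective (fun g : X 0 →ₗ[R] U => g ∘ₗ η) ∧
    Function.Exact (fun g : X 1 →ₗ[R] U => g ∘ₗ d 0) (fun g : X 0 →ₗ[R] U => g ∘ₗ η) ∧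
    ∀ i, Function.Exact (fun g : X (i + 2) →ₗ[R] U => g ∘ₗ d (i + 1))
      (fun g : X (i + 1) →ₗ[R] U => g ∘ₗ d i)

/-- There is an exact sequence `0 → Uₙ → ⋯ → U₁ → U₀ → A → 0` with all `Uᵢ` in `add-lim U`
(written as a sequence indexed by `ℕ` whose terms of index `> n` vanish). -/
def HasAddLimResolution (A : Type u) [AddCommGroup A] [Module R A] (n : ℕ) : Prop :=
  ∃ (X : ℕ → ModuleCat.{u} R) (d : ∀ i, X (i + 1) →ₗ[R] X i) (ε : X 0 →ₗ[R] A),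
    (∀ i, IsInAddLim R U (X i)) ∧ (∀ i, n < i → Subsingleton (X i)) ∧
    Function.Surjective ε ∧ Function.Exact (d 0) ε ∧ ∀ i, Function.Exact (d (i + 1)) (d i)

/-- The `U`-limit dimension of `A`: the infimum of the lengths of the finite resolutions of `A` by
modules in `add-lim U`, and `⊤` if there is none. -/
def limDim (A : Type u) [AddCommGroup A] [Module R A] : ℕ∞ :=
  ⨅ (n : ℕ) (_ : HasAddLimResolution R U A n), (n : ℕ∞)

/-- A minimal injective resolution `0 → U → E₀ → E₁ → ⋯` of `U`: an exact sequence with all `Eᵢ`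
injective such that the image of each map is essential in its target. -/
structure MinimalInjectiveResolution where
  E : ℕ → ModuleCat.{u} R
  η : U →ₗ[R] E 0
  α : ∀ i, E i →ₗ[R] E (i + 1)
  injective : ∀ i, Module.Injective R (E i)
  injective_η : Function.Injective η
  exact_zero : Function.Exact η (α 0)
  exact_succ : ∀ i, Function.Exact (α i) (α (i + 1))
  essential_zero : ∀ L : Submodule R (E 0), L ⊓ LinearMap.range η = ⊥ → L = ⊥
  essential_succ : ∀ i, ∀ L : Submodule R (E (i + 1)), L ⊓ LinearMap.range (α i) = ⊥ → L = ⊥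

/-- `^{⊥_n}U`: the finitely generated `M` with `Ext^i_R(M, U) = 0` for `1 ≤ i ≤ n`. -/
def perpClass (n : ℕ) : ObjectProperty (ModuleCat.{u} R) := fun M =>
  Module.Finite R M ∧ ∀ i : ℕ, 1 ≤ i → i ≤ n → Subsingleton (Ext.{u} M (ModuleCat.of R U) i)

/-- `H_n(U)`: the finitely generated `M` with `Ext^i_R(M, U) = 0` for all `i ≥ 0` with `i ≠ n`. -/
def hClass (n : ℕ) : ObjectProperty (ModuleCat.{u} R) := fun M =>
  Module.Finite R M ∧ ∀ i : ℕ, i ≠ n → Subsingleton (Ext.{u} M (ModuleCat.of R U) i)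

/-- `\overline{H_n(U)}`: the finitely generated `M` all of whose nonzero submodules lie in
`H_n(U)`. -/
def hBarClass (n : ℕ) : ObjectProperty (ModuleCat.{u} R) := fun M =>
  Module.Finite R M ∧ ∀ L : Submodule R M, L ≠ ⊥ → hClass R U n (ModuleCat.of R L)

variable {R}

/-- A class of modules is submodule-closed if every nonzero submodule of a module in the class is
in the class. -/
def IsSubmoduleClosed (P : ObjectProperty (ModuleCat.{u} R)) : Prop :=
  ∀ M : ModuleCat.{u} R, P M → ∀ L : Submodule R M, L ≠ ⊥ → P (ModuleCat.of R L)

end LeftModules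

/-! ### Bimodules -/

section Bimodules

variable (R S : Type u) [Ring R] [Ring S] (U : Type u) [AddCommGroup U] [Module R U]
  [Module Sᵐᵒᵖ U] [SMulCommClass R Sᵐᵒᵖ U]

/-- `S = End(_R U)`, acting on the right of `U`: the natural ring homomorphism from `Sᵐᵒᵖ` to the
ring of `R`-linear endomorphisms of `U` is an isomorphism. -/
def IsEndomorphismRing : Prop :=
  haveI : SMulCommClass Sᵐᵒᵖ R U := SMulCommClass.symm R Sᵐᵒᵖ U
  Function.Bijective (Module.toModuleEnd R (S := Sᵐᵒᵖ) U)

/-- `M` is `U`-torsionless: the evaluation map `M → Hom_S(Hom_R(M, U), U)` is injective. -/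
def IsTorsionless (M : Type u) [AddCommGroup M] [Module R M] : Prop :=
  Function.Injective
    (LinearMap.applyₗ' Sᵐᵒᵖ : M →+ ((M →ₗ[R] U) →ₗ[Sᵐᵒᵖ] U))

variable {R} in
/-- A class of modules has the `U`-torsionless property if all its members are `U`-torsionless. -/
def HasTorsionlessProperty (P : ObjectProperty (ModuleCat.{u} R)) : Prop :=
  ∀ M : ModuleCat.{u} R, P M → IsTorsionless R S U M

variable {R} in
/-- Left multiplication by `r : R` as an endomorphism of the right `S`-module `U`. -/
def leftMul (r : R) : ModuleCat.of Sᵐᵒᵖ U ⟶ ModuleCat.of Sᵐᵒᵖ U :=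
  ModuleCat.ofHom (Module.toModuleEnd Sᵐᵒᵖ U r)

/-- The left `R`-module structure of `Ext^n_S(N, U)` that comes, by functoriality in the second
variable, from the left action of `R` on the right `S`-module `U`. -/
@[reducible]
def extModule (N : ModuleCat.{u} Sᵐᵒᵖ) (n : ℕ) :
    Module R (Ext.{u} N (ModuleCat.of Sᵐᵒᵖ U) n) where
  smul r e := e.comp (Ext.mk₀ (leftMul S U r)) (add_zero n)
  one_smul e := by
    change e.comp (Ext.mk₀ (leftMul S U (1 : R))) (add_zero n) = e
    have h : leftMul S U (1 : R) = 𝟙 _ := by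
      ext x
      simp [leftMul]
    rw [h, Ext.comp_mk₀_id]
  mul_smul r s e := by
    change e.comp (Ext.mk₀ (leftMul S U (r * s))) (add_zero n) =
      (e.comp (Ext.mk₀ (leftMul S U s)) (add_zero n)).comp
        (Ext.mk₀ (leftMul S U r)) (add_zero n)
    have h : leftMul S U (r * s) = leftMul S U s ≫ leftMul S U r := by
      ext x
      exact mul_smul r s (show U from x)
    rw [h, ← Ext.mk₀_comp_mk₀, Ext.comp_assoc_of_third_deg_zero]
  smul_zero r := by
    change (0 : Ext.{u} N (ModuleCat.of Sᵐᵒᵖ U) n).comp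
      (Ext.mk₀ (leftMul S U r)) (add_zero n) = 0
    rw [Ext.zero_comp]
  smul_add r e₁ e₂ := by
    change (e₁ + e₂).comp (Ext.mk₀ (leftMul S U r)) (add_zero n) =
      e₁.comp (Ext.mk₀ (leftMul S U r)) (add_zero n) +
        e₂.comp (Ext.mk₀ (leftMul S U r)) (add_zero n)
    rw [Ext.add_comp]
  add_smul r s e := by
    change e.comp (Ext.mk₀ (leftMul S U (r + s))) (add_zero n) =
      e.comp (Ext.mk₀ (leftMul S U r)) (add_zero n) +
        e.comp (Ext.mk₀ (leftMul S U s)) (add_zero n)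
    have h : leftMul S U (r + s) = leftMul S U r + leftMul S U s := by
      ext x
      exact add_smul r s (show U from x)
    rw [h, Ext.mk₀_add, Ext.comp_add]
  zero_smul e := by
    change e.comp (Ext.mk₀ (leftMul S U (0 : R))) (add_zero n) = 0
    have h : leftMul S U (0 : R) = 0 := by
      ext x
      simp [leftMul]
    rw [h, Ext.mk₀_zero, Ext.comp_zero]

/-- `E_n(U_S)`: the finitely generated left `R`-modules isomorphic to `Ext^n_S(N, U)` for some
finitely generated right `S`-module `N`. -/
def eClass (n : ℕ) : ObjectProperty (ModuleCat.{u} R) := fun M =>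
  Module.Finite R M ∧ ∃ N : ModuleCat.{u} Sᵐᵒᵖ, Module.Finite Sᵐᵒᵖ N ∧
    letI := extModule R S U N n
    Nonempty (M ≃ₗ[R] Ext.{u} N (ModuleCat.of Sᵐᵒᵖ U) n)

end Bimodules

end

/-! For an injective module E, the `U`-limit dimension is the flat dimension of the left S-module
Hom_R(U, E) in disguise. It is at most m exactly when Tor_{m+1}^S(N, Hom_R(U, E)) = 0 for all
finitely generated N, and by injectivity of E this Tor group is Hom_R(Ext_S^{m+1}(N, U), E)
(`IsGeneralizedTilting.limDim_le_iff`). For E = E_0 ⊕ ... ⊕ E_{n-1}, minimality of the resolution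
turns Hom_R(X, E) = 0 into Ext_R^i(L, U) = 0 for all i < n and all submodules L of X
(`forall_hom_eq_zero_iff`). With the bound on the injective dimension taking care of i > n,
condition 1 thus says that `eClass` is contained in `hBarClass`. The inclusions of `hBarClass` in
`hClass` and of `hClass` in `eClass` always hold, so condition 1 makes the three classes equal, and
`hBarClass` is submodule-closed. Conversely, 2 and 3 each put every nonzero submodule of a module in
`eClass` into `hClass`.

Free resolutions over S are handled through their U-duals. As S = End(U), a finitely generated free
resolution of a right S-module is the dual of a sequence of maps between powers of U, each a weak
cokernel of the one before; applying Hom_R(-, K) instead of Hom_R(-, U) computes Tor with Hom_R(U,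
K). The limit dimension then yields to dimension shifting, starting from a Lazard-type criterion
(`isInAddLim_of_torVanishing_zero`) that uses the coresolution of R.

For `hClass` inside `eClass`, the coresolution shows that R agrees with its double U-dual and that
Ext_S^j(Hom_R(R, U), U) = 0 for j > 0. Hence the dual of a free resolution of M can be used to
compute Ext_S(-, U), and M is recovered as Ext_S^n of a transpose. -/

/-! ### Direct limits of powers of U and a Lazard-type criterion. -/

section Modules

variable {R : Type u} [Ring R]

/-- A linear map that kills the kernel of a surjection factors through it. -/
theorem LinearMap.exists_comp_eq_of_ker_le {X Y Z : Type*} [AddCommGroup X] [AddCommGroup Y]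
    [AddCommGroup Z] [Module R X] [Module R Y] [Module R Z] {p : X →ₗ[R] Y}
    (hp : Function.Surjective p) {f : X →ₗ[R] Z} (h : LinearMap.ker p ≤ LinearMap.ker f) :
    ∃ g : Y →ₗ[R] Z, g ∘ₗ p = f := by
  refine ⟨(LinearMap.ker p).liftQ f h ∘ₗ (p.quotKerEquivOfSurjective hp).symm.toLinearMap, ?_⟩
  ext x
  have : (p.quotKerEquivOfSurjective hp).symm (p x) = Submodule.Quotient.mk x := by
    rw [LinearEquiv.symm_apply_eq]; rfl
  simp [this]

variable {U : Type u} [AddCommGroup U] [Module R U]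

theorem IsInAddLim.of_retract {V W : Type u} [AddCommGroup V] [Module R V] [AddCommGroup W]
    [Module R W] (hV : IsInAddLim R U V) (i : W →ₗ[R] V) (p : V →ₗ[R] W)
    (h : p ∘ₗ i = LinearMap.id) : IsInAddLim R U W := by
  obtain ⟨ι, h1, h2, h3, h4, k, f, h5, s, q, hsq⟩ := hV
  refine ⟨ι, h1, h2, h3, h4, k, f, h5, s ∘ₗ i, p ∘ₗ q, ?_⟩
  rw [LinearMap.comp_assoc, ← LinearMap.comp_assoc i, hsq, LinearMap.id_comp, h]

/-- A map from a finitely generated module over a noetherian ring to a module in `add-lim U`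
factors through a finite power of `U`, without changing its kernel. -/
theorem IsInAddLim.exists_factor {V : Type u} [AddCommGroup V] [Module R V]
    (hV : IsInAddLim R U V) [IsNoetherianRing R] {C : Type*} [AddCommGroup C] [Module R C]
    [Module.Finite R C] (f : C →ₗ[R] V) :
    ∃ (k : ℕ) (h : C →ₗ[R] (Fin k → U)) (g : (Fin k → U) →ₗ[R] V),
      g ∘ₗ h = f ∧ LinearMap.ker f ≤ LinearMap.ker h := by
  obtain ⟨ι, h1, h2, h3, h4, k, F, h5, s, q, hsq⟩ := hV
  obtain ⟨n, π, hπ⟩ := Module.Finite.exists_fin' R C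
  set φ := (s ∘ₗ f) ∘ₗ π with hφ
  choose i x hx using fun t : Fin n => Module.DirectLimit.exists_of (φ (Pi.single t 1))
  obtain ⟨M, hM⟩ := Finite.exists_le i
  let ψ : (Fin n → R) →ₗ[R] (Fin (k M) → U) :=
    (Pi.basisFun R (Fin n)).constr ℤ (fun t => F (i t) M (hM t) (x t))
  have hψ : Module.DirectLimit.of R ι (fun i => Fin (k i) → U) F M ∘ₗ ψ = φ := by
    refine (Pi.basisFun R (Fin n)).ext fun t => ?_
    simp only [ψ, LinearMap.comp_apply, Module.Basis.constr_basis, Module.DirectLimit.of_f, hx]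
    simp
  -- `C` is finitely presented: the finitely many generators of the relations already vanish at some
  -- later stage of the limit.
  obtain ⟨S, hS⟩ := (inferInstance : IsNoetherian R (Fin n → R)).noetherian (LinearMap.ker φ)
  have hz : ∀ y : S, ∃ j, ∃ h : M ≤ j, F M j h (ψ y) = 0 := by
    intro y
    have hy : φ y = 0 := by
      rw [← LinearMap.mem_ker, ← hS]; exact Submodule.subset_span y.2
    rw [← hψ] at hy
    exact Module.DirectLimit.of.zero_exact hy
  choose j hMj hj using hz
  obtain ⟨J', hJ'⟩ := Finite.exists_le j
  obtain ⟨J, hJJ', hMJ⟩ := exists_ge_ge J' M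
  let ψ' : (Fin n → R) →ₗ[R] (Fin (k J) → U) := F M J hMJ ∘ₗ ψ
  have hker : LinearMap.ker φ ≤ LinearMap.ker ψ' := by
    rw [← hS, Submodule.span_le]
    intro y hy
    have : F M J hMJ (ψ y) = F (j ⟨y, hy⟩) J ((hJ' _).trans hJJ')
        (F M (j ⟨y, hy⟩) (hMj _) (ψ y)) :=
      (DirectedSystem.map_map (f := fun i j h => F i j h) (hMj ⟨y, hy⟩)
        ((hJ' _).trans hJJ') _).symm
    simp only [SetLike.mem_coe, LinearMap.mem_ker, ψ', LinearMap.comp_apply, this]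
    have h0 := hj ⟨y, hy⟩
    simp only at h0
    rw [h0, map_zero]
  obtain ⟨h, hh⟩ := LinearMap.exists_comp_eq_of_ker_le hπ (f := ψ')
    (le_trans (fun y hy => by
      simp only [LinearMap.mem_ker] at hy ⊢
      simp [hφ, hy]) hker)
  refine ⟨k J, h, q ∘ₗ Module.DirectLimit.of R ι (fun i => Fin (k i) → U) F J, ?_, ?_⟩
  · rw [← LinearMap.cancel_right hπ]
    refine LinearMap.ext fun t => ?_
    have h1 : Module.DirectLimit.of R ι (fun i => Fin (k i) → U) F J (h (π t)) = φ t := by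
      rw [← LinearMap.comp_apply h, hh, ← hψ]
      simp [ψ', Module.DirectLimit.of_f]
    have h2 := LinearMap.congr_fun hsq (f (π t))
    simpa [h1, hφ] using h2
  · intro c hc
    obtain ⟨y, rfl⟩ := hπ c
    have : ψ' y = 0 := hker (by simpa [hφ] using congrArg s hc)
    rw [LinearMap.mem_ker, ← LinearMap.comp_apply h, hh, this]

/-- Two maps out of powers of `U` jointly factor through one power of `U`. -/
theorem exists_amalgam_pi {K : Type*} [AddCommGroup K] [Module R K] {k k' : ℕ}
    (g : (Fin k → U) →ₗ[R] K) (g' : (Fin k' → U) →ₗ[R] K) :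
    ∃ (l : ℕ) (a : (Fin k → U) →ₗ[R] (Fin l → U)) (b : (Fin k' → U) →ₗ[R] (Fin l → U))
      (G : (Fin l → U) →ₗ[R] K), G ∘ₗ a = g ∧ G ∘ₗ b = g' := by
  let E : ((Fin k → U) × (Fin k' → U)) ≃ₗ[R] (Fin (k + k') → U) :=
    (LinearEquiv.sumArrowLequivProdArrow (Fin k) (Fin k') R U).symm ≪≫ₗ
      LinearEquiv.funCongrLeft R U finSumFinEquiv.symm
  refine ⟨k + k', E.toLinearMap ∘ₗ LinearMap.inl R _ _, E.toLinearMap ∘ₗ LinearMap.inr R _ _,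
    (LinearMap.coprod g g') ∘ₗ E.symm.toLinearMap, ?_, ?_⟩ <;>
  · refine LinearMap.ext fun x => ?_
    simp only [LinearMap.comp_apply, LinearEquiv.coe_coe, LinearEquiv.symm_apply_apply]
    simp

/-- The condition that a relation in the domain of a map `U^k → K` is resolved by factoring the map
through another power of `U`. -/
def ResolvesRelations (U : Type u) [AddCommGroup U] [Module R U]
    (K : Type u) [AddCommGroup K] [Module R K] : Prop :=
  ∀ (k : ℕ) (f : (Fin k → U) →ₗ[R] K) (x : Fin k → U), f x = 0 →
    ∃ (l : ℕ) (h : (Fin k → U) →ₗ[R] (Fin l → U)) (g : (Fin l → U) →ₗ[R] K),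
      g ∘ₗ h = f ∧ h x = 0

theorem ResolvesRelations.exists_factor_finset {K : Type u} [AddCommGroup K] [Module R K]
    (hK : ResolvesRelations (R := R) U K) {k : ℕ} (f : (Fin k → U) →ₗ[R] K)
    (s : Set (Fin k → U)) (hs : s.Finite) (hf : ∀ x ∈ s, f x = 0) :
    ∃ (l : ℕ) (h : (Fin k → U) →ₗ[R] (Fin l → U)) (g : (Fin l → U) →ₗ[R] K),
      g ∘ₗ h = f ∧ ∀ x ∈ s, h x = 0 := by
  induction s, hs using Set.Finite.induction_on with
  | empty => exact ⟨k, LinearMap.id, f, rfl, by simp⟩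
  | @insert x s _ _ ih =>
    obtain ⟨l, h, g, hgh, hz⟩ := ih fun y hy => hf y (Set.mem_insert_of_mem _ hy)
    obtain ⟨l', h', g', hgh', hz'⟩ := hK l g (h x) (by
      rw [← LinearMap.comp_apply, hgh]; exact hf x (Set.mem_insert _ _))
    refine ⟨l', h' ∘ₗ h, g', by rw [← LinearMap.comp_assoc, hgh', hgh], ?_⟩
    rintro y (rfl | hy)
    · exact hz'
    · simp [hz y hy]

variable (R U) in
/-- The category of maps from finite powers of `U` to `K`. -/
structure PowerOver (K : Type u) [AddCommGroup K] [Module R K] where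
  rank : ℕ
  map : (Fin rank → U) →ₗ[R] K

instance PowerOver.category (K : Type u) [AddCommGroup K] [Module R K] :
    SmallCategory (PowerOver R U K) where
  Hom X Y := {h : (Fin X.rank → U) →ₗ[R] (Fin Y.rank → U) // Y.map ∘ₗ h = X.map}
  id X := ⟨LinearMap.id, rfl⟩
  comp f g := ⟨g.1 ∘ₗ f.1, by rw [← LinearMap.comp_assoc, g.2, f.2]⟩

/-- Two parallel maps over `K` are equalized by resolving the relations (f - g)(x), where x runs
over finitely many generators of the source. -/
theorem ResolvesRelations.isFiltered {K : Type u} [AddCommGroup K] [Module R K]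
    [Module.Finite R U] (hK : ResolvesRelations (R := R) U K) :
    IsFiltered (PowerOver R U K) where
  cocone_objs X Y := by
    obtain ⟨l, a, b, G, ha, hb⟩ := exists_amalgam_pi X.map Y.map
    exact ⟨⟨l, G⟩, ⟨a, ha⟩, ⟨b, hb⟩, trivial⟩
  cocone_maps X Y f g := by
    obtain ⟨s, hs⟩ := Module.Finite.fg_top (R := R) (M := Fin X.rank → U)
    obtain ⟨l, h, G, hG, hz⟩ := hK.exists_factor_finset Y.map
      ((f.1 - g.1) '' s) (s.finite_toSet.image _) (by
        rintro _ ⟨x, _, rfl⟩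
        have h1 := LinearMap.congr_fun f.2 x
        have h2 := LinearMap.congr_fun g.2 x
        simp only [LinearMap.comp_apply] at h1 h2
        simp [h1, h2])
    refine ⟨⟨l, G⟩, ⟨h, hG⟩, Subtype.ext ?_⟩
    change h ∘ₗ f.1 = h ∘ₗ g.1
    refine LinearMap.ext_on (s := (s : Set (Fin X.rank → U))) hs fun x hx => ?_
    have := hz _ ⟨x, hx, rfl⟩
    rw [LinearMap.sub_apply, map_sub, sub_eq_zero] at this
    exact this
  nonempty := ⟨⟨0, 0⟩⟩

/-- A version of Lazard's theorem: a module that is generated by `U` and whose relations are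
resolved by powers of `U` is a direct limit of powers of `U`. -/
theorem ResolvesRelations.isInAddLim {K : Type u} [AddCommGroup K] [Module R K]
    [Module.Finite R U] (hK : ResolvesRelations (R := R) U K)
    (hgen : ∀ x : K, ∃ (k : ℕ) (f : (Fin k → U) →ₗ[R] K), x ∈ LinearMap.range f) :
    IsInAddLim R U K := by
  classical
  have := hK.isFiltered
  -- A directed set with a final functor to the filtered category of powers of U over `K` replaces
  -- that category as the index of the limit.
  obtain ⟨α, hα, hdir, hne, F, hF⟩ := IsFiltered.exists_directed (PowerOver R U K)
  rw [Functor.final_iff_of_isFiltered] at hF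
  obtain ⟨hF1, hF2⟩ := hF
  let f : ∀ i j, i ≤ j → (Fin (F.obj i).rank → U) →ₗ[R] (Fin (F.obj j).rank → U) :=
    fun i j h => (F.map (homOfLE h)).1
  have hsys : DirectedSystem (fun i => Fin (F.obj i).rank → U) (fun i j h => f i j h) :=
    { map_self := fun i x => by
        change (F.map (homOfLE le_rfl)).1 x = x
        rw [show homOfLE (le_refl i) = 𝟙 i from rfl, F.map_id]; rfl
      map_map := fun i j k hij hjk x => by
        change (F.map (homOfLE hjk)).1 ((F.map (homOfLE hij)).1 x) =
          (F.map (homOfLE (hij.trans hjk))).1 x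
        rw [show homOfLE (hij.trans hjk) = homOfLE hij ≫ homOfLE hjk from rfl, F.map_comp]; rfl }
  let L := Module.DirectLimit.lift R α (fun i => Fin (F.obj i).rank → U) f
    (fun i => (F.obj i).map) (fun i j hij x => LinearMap.congr_fun (F.map (homOfLE hij)).2 x)
  have hsurj : Function.Surjective L := by
    intro x
    obtain ⟨k, g, y, rfl⟩ := hgen x
    obtain ⟨i, ⟨t⟩⟩ := hF1 ⟨k, g⟩
    refine ⟨Module.DirectLimit.of R α _ f i (t.1 y), ?_⟩
    simp only [L, Module.DirectLimit.lift_of]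
    exact LinearMap.congr_fun t.2 y
  have hinj : Function.Injective L := by
    rw [injective_iff_map_eq_zero]
    intro z hz
    obtain ⟨i, x, rfl⟩ := Module.DirectLimit.exists_of z
    simp only [L, Module.DirectLimit.lift_of] at hz
    -- The element dies in some power of U over `K`; finality maps that power back into the directed
    -- system and, further along, identifies this detour with a transition map.
    obtain ⟨l, h, g, hgh, hx⟩ := hK _ (F.obj i).map x hz
    let a : F.obj i ⟶ ⟨l, g⟩ := ⟨h, hgh⟩
    obtain ⟨j, ⟨t⟩⟩ := hF1 ⟨l, g⟩
    obtain ⟨m, him, hjm⟩ := exists_ge_ge i j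
    obtain ⟨c, s, hs⟩ := hF2 (a ≫ t ≫ F.map (homOfLE hjm)) (F.map (homOfLE him))
    have h0 : (F.map (homOfLE him) ≫ F.map s).1 x = 0 := by
      rw [← hs]
      change (F.map s).1 ((F.map (homOfLE hjm)).1 (t.1 (h x))) = 0
      rw [hx, map_zero, map_zero, map_zero]
    rw [← F.map_comp] at h0
    rw [← Module.DirectLimit.of_f (hij := him.trans (leOfHom s))]
    change Module.DirectLimit.of R α _ f c ((F.map _).1 x) = 0
    rw [show homOfLE (him.trans (leOfHom s)) = homOfLE him ≫ s from Subsingleton.elim _ _, h0,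
      map_zero]
  let e := LinearEquiv.ofBijective L ⟨hinj, hsurj⟩
  exact ⟨α, inferInstance, Classical.decEq _, hne, hdir, fun i => (F.obj i).rank, f, hsys,
    e.symm.toLinearMap, e.toLinearMap, by ext x; simp⟩

/-- Direct sums of copies of `U` lie in `add-lim U`. -/
theorem IsInAddLim.finsupp [Module.Finite R U] (X : Type u) : IsInAddLim R U (X →₀ U) := by
  classical
  refine ResolvesRelations.isInAddLim ?_ ?_
  · intro k f x hx
    obtain ⟨s, hs⟩ := Module.Finite.fg_top (R := R) (M := Fin k → U)
    -- As the source is finitely generated, `f` lands in finitely many coordinates, so it factors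
    -- through a finite power of U embedded in the direct sum.
    let t : Finset X := s.biUnion fun y => (f y).support
    let e := t.equivFin
    let h : (Fin k → U) →ₗ[R] (Fin t.card → U) :=
      LinearMap.pi fun i => Finsupp.lapply (e.symm i : X) ∘ₗ f
    let g : (Fin t.card → U) →ₗ[R] (X →₀ U) :=
      ∑ i, Finsupp.lsingle (e.symm i : X) ∘ₗ LinearMap.proj i
    refine ⟨t.card, h, g, ?_, ?_⟩
    · refine LinearMap.ext_on (s := (s : Set (Fin k → U))) hs fun y hy => ?_
      have hsub : (f y).support ⊆ t := Finset.subset_biUnion_of_mem (fun y => (f y).support) hy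
      have : ∑ i, Finsupp.single (e.symm i : X) (f y (e.symm i)) = f y := by
        rw [Equiv.sum_comp e.symm (fun a : t => Finsupp.single (a : X) (f y a)),
          Finset.sum_coe_sort t (fun a => Finsupp.single a (f y a))]
        conv_rhs => rw [← Finsupp.sum_single (f y)]
        rw [Finsupp.sum_of_support_subset _ hsub _ (by simp)]
      simpa [g, h] using this
    · ext i
      simp [h, hx]
  · intro x
    induction x using Finsupp.induction_linear with
    | zero => exact ⟨0, 0, 0, rfl⟩
    | add a b ha hb =>
      obtain ⟨k, f, y, rfl⟩ := ha
      obtain ⟨k', f', y', rfl⟩ := hb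
      obtain ⟨l, p, q, G, hp, hq⟩ := exists_amalgam_pi f f'
      exact ⟨l, G, p y + q y', by simp [← hp, ← hq]⟩
    | single a b =>
      exact ⟨1, Finsupp.lsingle a ∘ₗ LinearMap.proj 0, fun _ => b, by simp⟩

end Modules

/-! ### Exactness under Hom(-, K) and dimension shifting in K. -/

section HomExact

variable {R : Type u} [Ring R]

/-- The sequence obtained from `X → Y → Z` by applying `Hom(-, K)` is exact in the middle
(in the sense that every map killed by the first arrow comes from the second one). -/
def HomExactAt {X Y Z : Type*} [AddCommGroup X] [AddCommGroup Y] [AddCommGroup Z] [Module R X]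
    [Module R Y] [Module R Z] (A : X →ₗ[R] Y) (B : Y →ₗ[R] Z)
    (K : Type*) [AddCommGroup K] [Module R K] : Prop :=
  ∀ f : Y →ₗ[R] K, f ∘ₗ A = 0 → ∃ g : Z →ₗ[R] K, g ∘ₗ B = f

variable {X Y Z T : Type u} [AddCommGroup X] [AddCommGroup Y] [AddCommGroup Z] [AddCommGroup T]
  [Module R X] [Module R Y] [Module R Z] [Module R T]
  {A : X →ₗ[R] Y} {B : Y →ₗ[R] Z} {C : Z →ₗ[R] T}
  {U : Type u} [AddCommGroup U] [Module R U]

theorem HomExactAt.pi (h : HomExactAt A B U) (ι : Type*) : HomExactAt A B (ι → U) := by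
  intro f hf
  choose g hg using fun i => h (LinearMap.proj i ∘ₗ f) (by
    rw [LinearMap.comp_assoc, hf, LinearMap.comp_zero])
  refine ⟨LinearMap.pi g, ?_⟩
  ext y i
  exact LinearMap.congr_fun (hg i) y

/-- A map to `V` factors through a power of U without gaining or losing kernel, so the factor still
kills `A` and extends along `B`. -/
theorem HomExactAt.of_isInAddLim [IsNoetherianRing R] [Module.Finite R Y] (h : HomExactAt A B U)
    {V : Type u} [AddCommGroup V] [Module R V] (hV : IsInAddLim R U V) : HomExactAt A B V := by
  intro f hf
  obtain ⟨k, a, g, rfl, hk⟩ := hV.exists_factor f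
  obtain ⟨b, rfl⟩ := h.pi (Fin k) a (by
    ext1 x
    exact hk (LinearMap.congr_fun hf x))
  exact ⟨g ∘ₗ b, LinearMap.comp_assoc _ _ _⟩

theorem HomExactAt.of_injective (h : Function.Exact A B) (E : Type u) [AddCommGroup E] [Module R E]
    [Module.Injective R E] : HomExactAt A B E := by
  intro f hf
  obtain ⟨g, hg⟩ := LinearMap.exists_comp_eq_of_ker_le B.surjective_rangeRestrict (f := f) (by
    intro y hy
    rw [LinearMap.ker_rangeRestrict, LinearMap.mem_ker] at hy
    obtain ⟨x, rfl⟩ := (h y).1 hy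
    exact LinearMap.congr_fun hf x)
  obtain ⟨g', hg'⟩ := Module.Injective.out (R := R) (Q := E) (LinearMap.range B).subtype
    (Submodule.subtype_injective _) g
  refine ⟨g', ?_⟩
  ext y
  exact (hg' ⟨B y, y, rfl⟩).trans (LinearMap.congr_fun hg y)

variable {V K : Type u} [AddCommGroup V] [AddCommGroup K] [Module R V] [Module R K]
  {p : V →ₗ[R] K}

/-- An extension `ψ` of `f` with values in `V` need not land in the kernel of `p`. The error `p ∘ₗ
ψ` kills `B`, hence comes from `C`; lifting it along `p` and subtracting corrects `ψ` without
changing its restriction along `B`. -/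
theorem HomExactAt.ker (hV : HomExactAt A B V) (hK : HomExactAt B C K) (hBC : C ∘ₗ B = 0)
    (hl : ∀ f : T →ₗ[R] K, ∃ f' : T →ₗ[R] V, p ∘ₗ f' = f) :
    HomExactAt A B (LinearMap.ker p) := by
  intro f hf
  obtain ⟨ψ, hψ⟩ := hV ((LinearMap.ker p).subtype ∘ₗ f) (by
    rw [LinearMap.comp_assoc, hf, LinearMap.comp_zero])
  obtain ⟨g, hg⟩ := hK (p ∘ₗ ψ) (by
    rw [LinearMap.comp_assoc, hψ]
    ext y
    exact (f y).2)
  obtain ⟨g', rfl⟩ := hl g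
  refine ⟨LinearMap.codRestrict _ (ψ - g' ∘ₗ C) fun z => ?_, ?_⟩
  · have := LinearMap.congr_fun hg z
    simp only [LinearMap.comp_apply] at this
    simp [this]
  · ext y
    have h1 := LinearMap.congr_fun hψ y
    have h2 := LinearMap.congr_fun hBC y
    simp only [LinearMap.comp_apply, Submodule.subtype_apply, LinearMap.zero_apply] at h1 h2
    simp [h1, h2]

/-- The converse shift: after lifting `f` to `V`, its composite with `B` lands in the kernel of `p`,
extends there along `B`, and can be subtracted. -/
theorem HomExactAt.of_ker (hK : HomExactAt A B (LinearMap.ker p)) (hV : HomExactAt B C V)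
    (hAB : B ∘ₗ A = 0) (hl : ∀ f : Z →ₗ[R] K, ∃ f' : Z →ₗ[R] V, p ∘ₗ f' = f) :
    HomExactAt B C K := by
  intro f hf
  obtain ⟨f', rfl⟩ := hl f
  obtain ⟨g, hg⟩ := hK (LinearMap.codRestrict _ (f' ∘ₗ B) fun y => LinearMap.congr_fun hf y) (by
    refine LinearMap.ext fun x => Subtype.ext ?_
    have := LinearMap.congr_fun hAB x
    change f' (B (A x)) = 0
    rw [← LinearMap.comp_apply B, this, LinearMap.zero_apply, map_zero])
  obtain ⟨h, hh⟩ := hV (f' - (LinearMap.ker p).subtype ∘ₗ g) (by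
    ext y
    have : ((g (B y) : LinearMap.ker p) : V) = f' (B y) :=
      congrArg Subtype.val (LinearMap.congr_fun hg y)
    simp [this])
  refine ⟨p ∘ₗ h, ?_⟩
  rw [LinearMap.comp_assoc, hh]
  ext z
  simp

/-- If every map from `U` lifts along `p : V → K`, then so does every map from a direct summand of a
finite power of `U`. -/
theorem exists_lift_of_isInAdd (hl : ∀ f : U →ₗ[R] K, ∃ f' : U →ₗ[R] V, p ∘ₗ f' = f)
    (hT : IsInAdd R U T) (f : T →ₗ[R] K) : ∃ f' : T →ₗ[R] V, p ∘ₗ f' = f := by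
  obtain ⟨k, i, q, hq⟩ := hT
  choose g hg using fun j => hl ((f ∘ₗ q) ∘ₗ LinearMap.single R (fun _ : Fin k => U) j)
  refine ⟨(∑ j, g j ∘ₗ LinearMap.proj j) ∘ₗ i, ?_⟩
  have : p ∘ₗ (∑ j, g j ∘ₗ LinearMap.proj j) = f ∘ₗ q := by
    refine LinearMap.pi_ext' fun j => ?_
    rw [← hg j]
    ext u
    simp [Pi.single_apply, apply_ite]
  rw [← LinearMap.comp_assoc, this, LinearMap.comp_assoc, hq, LinearMap.comp_id]

theorem isInAdd_pi (k : ℕ) : IsInAdd R U (Fin k → U) := ⟨k, LinearMap.id, LinearMap.id, rfl⟩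

end HomExact

/-! ### Weak cokernels and the vanishing of Tor over S. -/

section WeakCokernel

variable {R : Type u} [Ring R] (U : Type u) [AddCommGroup U] [Module R U]

/-- `B` is a weak cokernel of `A` with respect to maps to `U`. -/
structure IsWeakCokernel {X Y Z : Type*} [AddCommGroup X] [AddCommGroup Y] [AddCommGroup Z]
    [Module R X] [Module R Y] [Module R Z] (A : X →ₗ[R] Y) (B : Y →ₗ[R] Z) : Prop where
  comp_eq_zero : B ∘ₗ A = 0
  homExactAt : HomExactAt A B U

/-- `A` is the last map of a sequence of `i + 1` composable maps between finite powers of `U` in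
which each map is a weak cokernel of its predecessor. -/
def IsWeakCokernelChain : (i : ℕ) → {p k : ℕ} → ((Fin p → U) →ₗ[R] (Fin k → U)) → Prop
  | 0, _, _, _ => True
  | i + 1, p, _, B => ∃ (m : ℕ) (A : (Fin m → U) →ₗ[R] (Fin p → U)),
      IsWeakCokernelChain i A ∧ IsWeakCokernel U A B

/-- The vanishing of `Tor_{i+1}^S(N, Hom_R(U, K))` for all finitely presented right modules `N` over
`S = End(U)`, expressed in terms of the duals of free resolutions. -/
def TorVanishing (i : ℕ) (K : Type u) [AddCommGroup K] [Module R K] : Prop :=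
  ∀ ⦃p k l : ℕ⦄ (A : (Fin p → U) →ₗ[R] (Fin k → U)) (B : (Fin k → U) →ₗ[R] (Fin l → U)),
    IsWeakCokernelChain U i A → IsWeakCokernel U A B → HomExactAt A B K

variable {U}

/-- This is the flatness of Hom_R(U, V) as a left S-module. -/
theorem IsInAddLim.torVanishing [IsNoetherianRing R] [Module.Finite R U]
    {V : Type u} [AddCommGroup V] [Module R V] (hV : IsInAddLim R U V) (i : ℕ) :
    TorVanishing (R := R) U i V :=
  fun _ _ _ _ _ _ h => h.homExactAt.of_isInAddLim hV

variable (R U) in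
/-- Every map between finite powers of `U` has a weak cokernel. -/
def HasWeakCokernels : Prop :=
  ∀ ⦃p k : ℕ⦄ (A : (Fin p → U) →ₗ[R] (Fin k → U)),
    ∃ (l : ℕ) (B : (Fin k → U) →ₗ[R] (Fin l → U)), IsWeakCokernel U A B

/-- Since maps from U lift along `p`, Hom_R(U, -) gives a short exact sequence with flat middle
term. The Tor groups of the two ends therefore differ by a shift; the weak cokernel of `B` continues
the resolution by one step. -/
theorem HasWeakCokernels.torVanishing_ker (hw : HasWeakCokernels R U) [IsNoetherianRing R]
    [Module.Finite R U] {V K : Type u} [AddCommGroup V] [AddCommGroup K] [Module R V] [Module R K]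
    (p : V →ₗ[R] K) (hV : IsInAddLim R U V)
    (hl : ∀ f : U →ₗ[R] K, ∃ f' : U →ₗ[R] V, p ∘ₗ f' = f) {i : ℕ}
    (hK : TorVanishing (R := R) U (i + 1) K) : TorVanishing (R := R) U i (LinearMap.ker p) := by
  intro _ _ _ A B hA hAB
  obtain ⟨q, C, hC⟩ := hw B
  exact (hV.torVanishing i A B hA hAB).ker (hK B C ⟨_, A, hA, hAB⟩ hC) hC.comp_eq_zero
    (exists_lift_of_isInAdd hl (isInAdd_pi q))

theorem TorVanishing.of_ker [IsNoetherianRing R] [Module.Finite R U] {V K : Type u}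
    [AddCommGroup V] [AddCommGroup K] [Module R V] [Module R K] (p : V →ₗ[R] K)
    (hV : IsInAddLim R U V) (hl : ∀ f : U →ₗ[R] K, ∃ f' : U →ₗ[R] V, p ∘ₗ f' = f) {i : ℕ}
    (hK : TorVanishing (R := R) U i (LinearMap.ker p)) : TorVanishing (R := R) U (i + 1) K := by
  rintro _ k _ B C ⟨_, A, hA, hAB⟩ hBC
  exact (hK A B hA hAB).of_ker (hBC.homExactAt.of_isInAddLim hV) hAB.comp_eq_zero
    (exists_lift_of_isInAdd hl (isInAdd_pi k))

/-- A map to an injective module extends along `B` precisely when it kills the kernel of `B`. -/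
theorem torVanishing_iff_of_injective (E : Type u) [AddCommGroup E] [Module R E]
    [Module.Injective R E] (i : ℕ) :
    TorVanishing (R := R) U i E ↔
      ∀ ⦃p k l : ℕ⦄ (A : (Fin p → U) →ₗ[R] (Fin k → U)) (B : (Fin k → U) →ₗ[R] (Fin l → U)),
        IsWeakCokernelChain U i A → IsWeakCokernel U A B →
        ∀ f : (Fin k → U) →ₗ[R] E, f ∘ₗ A = 0 → LinearMap.ker B ≤ LinearMap.ker f := by
  refine ⟨fun h p k l A B hA hB f hf => ?_, fun h p k l A B hA hB f hf => ?_⟩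
  · obtain ⟨g, rfl⟩ := h A B hA hB f hf
    exact LinearMap.ker_le_ker_comp B g
  · have hex : Function.Exact (LinearMap.ker B).subtype B := LinearMap.exact_subtype_ker_map B
    refine HomExactAt.of_injective hex E f ?_
    ext y
    exact h A B hA hB f hf y.2

variable {S : Type u} [Ring S] [Module Sᵐᵒᵖ U] [SMulCommClass R Sᵐᵒᵖ U]

theorem IsEndomorphismRing.exists_smul_id (hS : IsEndomorphismRing R S U) (f : U →ₗ[R] U) :
    ∃ s : Sᵐᵒᵖ, s • LinearMap.id = f := by
  obtain ⟨s, rfl⟩ := hS.2 f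
  exact ⟨s, rfl⟩

theorem IsEndomorphismRing.finite_dual_pi (hS : IsEndomorphismRing R S U) (k : ℕ) :
    Module.Finite Sᵐᵒᵖ ((Fin k → U) →ₗ[R] U) := by
  refine Module.Finite.of_surjective (Fintype.linearCombination Sᵐᵒᵖ
    (fun i : Fin k => (LinearMap.proj i : (Fin k → U) →ₗ[R] U))) fun g => ?_
  choose s hs using fun i => hS.exists_smul_id (g ∘ₗ LinearMap.single R (fun _ => U) i)
  refine ⟨s, LinearMap.pi_ext' fun i => ?_⟩
  rw [← hs i]
  ext u
  simp [Fintype.linearCombination_apply, Pi.single_apply, apply_ite]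

/-- The maps U^k → U that kill `A` form an S-submodule of a noetherian module; finitely many
generators serve as the coordinates of `B`. -/
theorem IsEndomorphismRing.hasWeakCokernels [IsNoetherianRing Sᵐᵒᵖ]
    (hS : IsEndomorphismRing R S U) : HasWeakCokernels R U := by
  intro p k A
  have := hS.finite_dual_pi k
  let N : Submodule Sᵐᵒᵖ ((Fin k → U) →ₗ[R] U) :=
    { carrier := {B | B ∘ₗ A = 0}
      add_mem' := fun {a b} ha hb => by
        simp only [Set.mem_ofPred_eq] at ha hb ⊢
        rw [LinearMap.add_comp, ha, hb, add_zero]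
      zero_mem' := LinearMap.zero_comp A
      smul_mem' := fun c b hb => by
        simp only [Set.mem_ofPred_eq] at hb ⊢
        rw [LinearMap.smul_comp, hb, smul_zero] }
  obtain ⟨l, B, hB⟩ := Submodule.fg_iff_exists_fin_generating_family.1
    ((inferInstance : IsNoetherian Sᵐᵒᵖ ((Fin k → U) →ₗ[R] U)).noetherian N)
  refine ⟨l, LinearMap.pi B, ?_, fun g hg => ?_⟩
  · have hmem : ∀ i, B i ∈ N := fun i => hB ▸ Submodule.subset_span ⟨i, rfl⟩
    ext1 i
    refine LinearMap.ext fun x => funext fun j => ?_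
    exact LinearMap.congr_fun (hmem j) (Pi.single i x)
  · have hgN : g ∈ N := hg
    rw [← hB, Submodule.mem_span_range_iff_exists_fun] at hgN
    obtain ⟨c, rfl⟩ := hgN
    refine ⟨∑ i, (c i • LinearMap.id : U →ₗ[R] U) ∘ₗ LinearMap.proj i, ?_⟩
    refine LinearMap.ext fun x => ?_
    simp

end WeakCokernel

/-! ### Finite resolutions by add-lim U versus vanishing of Tor. -/

section Resolution

variable {R : Type u} [Ring R] {U : Type u} [AddCommGroup U] [Module R U]

/-- Two finite `add-lim U`-resolutions can be spliced. -/
theorem HasAddLimResolution.splice {V A : Type u} [AddCommGroup V] [Module R V] [AddCommGroup A]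
    [Module R A] (hV : IsInAddLim R U V) (p : V →ₗ[R] A) (hp : Function.Surjective p) {m : ℕ}
    (h : HasAddLimResolution R U (LinearMap.ker p) m) : HasAddLimResolution R U A (m + 1) := by
  obtain ⟨X, d, ε, hX, hX0, hε, hdε, hd⟩ := h
  let X' : ℕ → ModuleCat.{u} R := fun i => match i with
    | 0 => ModuleCat.of R V
    | i + 1 => X i
  let d' : ∀ i, X' (i + 1) →ₗ[R] X' i := fun i => match i with
    | 0 => (LinearMap.ker p).subtype ∘ₗ ε
    | i + 1 => d i
  refine ⟨X', d', p, ?_, ?_, hp, ?_, ?_⟩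
  · rintro (_ | i)
    · exact hV
    · exact hX i
  · rintro (_ | i) hi
    · omega
    · exact hX0 i (by omega)
  · intro x
    constructor
    · intro hx
      obtain ⟨y, hy⟩ := hε ⟨x, hx⟩
      exact ⟨y, congrArg Subtype.val hy⟩
    · rintro ⟨y, rfl⟩
      exact (ε y).2
  · rintro (_ | i)
    · intro x
      refine Iff.trans ?_ (hdε x)
      exact Submodule.coe_eq_zero
    · exact hd i

theorem hasAddLimResolution_zero {A : Type u} [AddCommGroup A] [Module R A]
    (hA : IsInAddLim R U A) : HasAddLimResolution R U A 0 := by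
  let X' : ℕ → ModuleCat.{u} R := fun i => match i with
    | 0 => ModuleCat.of R A
    | _ + 1 => ModuleCat.of R PUnit.{u + 1}
  have hsub : ∀ i, Subsingleton (X' (i + 1)) := fun i =>
    inferInstanceAs (Subsingleton PUnit.{u + 1})
  refine ⟨X', fun i => 0, LinearMap.id, ?_, ?_, Function.surjective_id, ?_, ?_⟩
  · rintro (_ | i)
    · exact hA
    · exact hA.of_retract 0 0 (LinearMap.ext fun x => (hsub i).elim _ _)
  · rintro (_ | i) hi
    · omega
    · exact hsub i
  · intro x
    exact ⟨fun hx => ⟨0, hx.symm⟩, fun ⟨y, hy⟩ => hy.symm⟩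
  · intro i x
    exact ⟨fun _ => ⟨0, (hsub i).elim _ _⟩, fun _ => rfl⟩

/-- A module with a finite `add-lim U`-resolution behaves like `U` with respect to projective
resolutions of `U`, and its `U`-Tor groups vanish above the length of the resolution. -/
theorem HasAddLimResolution.homExactAt_and_torVanishing [IsNoetherianRing R] [Module.Finite R U]
    {P : ℕ → ModuleCat.{u} R} {d : ∀ i, P (i + 1) →ₗ[R] P i} {ε : P 0 →ₗ[R] U}
    (hPf : ∀ i, Module.Finite R (P i)) (hPp : ∀ i, Module.Projective R (P i))
    (hε : Function.Surjective ε) (hdε : Function.Exact (d 0) ε)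
    (hd : ∀ i, Function.Exact (d (i + 1)) (d i))
    (hU : ∀ i, HomExactAt (d (i + 1)) (d i) U) {m : ℕ} :
    ∀ {A : Type u} [AddCommGroup A] [Module R A], HasAddLimResolution R U A m →
      (∀ i, HomExactAt (d (i + 1)) (d i) A) ∧ ∀ i, m ≤ i → TorVanishing (R := R) U i A := by
  induction m with
  | zero =>
    rintro A _ _ ⟨X, D, δ, hX, hX0, hδ, hDδ, hD⟩
    have := hX0 1 one_pos
    have hinj : Function.Injective δ := by
      rw [injective_iff_map_eq_zero]
      intro x hx
      obtain ⟨y, rfl⟩ := (hDδ x).1 hx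
      rw [Subsingleton.elim y 0, map_zero]
    let e := LinearEquiv.ofBijective δ ⟨hinj, hδ⟩
    have hA : IsInAddLim R U A := (hX 0).of_retract e.symm.toLinearMap e.toLinearMap (by
      ext x; simp)
    exact ⟨fun i => (hU i).of_isInAddLim hA, fun i _ => hA.torVanishing i⟩
  | succ m ih =>
    rintro A _ _ ⟨X, D, δ, hX, hX0, hδ, hDδ, hD⟩
    obtain ⟨h1, h2⟩ := @ih (LinearMap.ker δ) _ _
      ⟨fun i => X (i + 1), fun i => D (i + 1),
        LinearMap.codRestrict _ (D 0) (fun x => (hDδ _).2 ⟨x, rfl⟩), fun i => hX _,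
        fun i hi => hX0 _ (by omega), fun x => by
          obtain ⟨y, hy⟩ := (hDδ x).1 x.2
          exact ⟨y, Subtype.ext hy⟩, fun x => by
          refine Iff.trans ?_ (hD 0 x)
          exact (Submodule.coe_eq_zero (p := LinearMap.ker δ)).symm, fun i => hD _⟩
    -- This is Ext_R^1(U, ker δ) = 0 by hand: lift `f ∘ₗ ε` to `ψ`; the cocycle `ψ ∘ₗ d 0` extends
    -- to a map `χ` into the kernel, and `ψ - χ` descends to U.
    have hlift : ∀ f : U →ₗ[R] A, ∃ f' : U →ₗ[R] X 0, δ ∘ₗ f' = f := by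
      intro f
      have := hPp 0
      obtain ⟨ψ, hψ⟩ := Module.projective_lifting_property δ (f ∘ₗ ε) hδ
      have hdd : ∀ x, ε (d 0 x) = 0 := fun x => (hdε _).2 ⟨x, rfl⟩
      obtain ⟨χ, hχ⟩ := h1 0 (LinearMap.codRestrict _ (ψ ∘ₗ d 0) (fun x => by
        have := LinearMap.congr_fun hψ (d 0 x)
        simpa [hdd] using this)) (by
          refine LinearMap.ext fun x => Subtype.ext ?_
          change ψ (d 0 (d 1 x)) = 0
          rw [(hd 0 _).2 ⟨x, rfl⟩, map_zero])
      obtain ⟨θ, hθ⟩ := LinearMap.exists_comp_eq_of_ker_le hε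
        (f := ψ - (LinearMap.ker δ).subtype ∘ₗ χ) (by
          intro x hx
          obtain ⟨y, rfl⟩ := (hdε x).1 hx
          have : ((χ (d 0 y) : LinearMap.ker δ) : X 0) = ψ (d 0 y) :=
            congrArg Subtype.val (LinearMap.congr_fun hχ y)
          simp [this])
      refine ⟨θ, ?_⟩
      rw [← LinearMap.cancel_right hε, LinearMap.comp_assoc, hθ, ← hψ]
      ext x
      simp
    constructor
    · intro i
      refine (h1 (i + 1)).of_ker ((hU i).of_isInAddLim (hX 0)) ?_ fun f => ?_
      · ext x
        exact (hd (i + 1) _).2 ⟨x, rfl⟩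
      · have := hPp (i + 1)
        exact Module.projective_lifting_property δ f hδ
    · rintro (_ | i) hi
      · omega
      · exact (h2 i (by omega)).of_ker δ (hX 0) hlift

/-- The terms of the sequence `0 → R → X₀ → X₁ → ⋯`. -/
def coresolutionObj (X : ℕ → ModuleCat.{u} R) : ℕ → ModuleCat.{u} R
  | 0 => ModuleCat.of R PUnit.{u + 1}
  | 1 => ModuleCat.of R R
  | i + 2 => X i

/-- The maps of the sequence `0 → R → X₀ → X₁ → ⋯`. -/
def coresolutionMap {X : ℕ → ModuleCat.{u} R} (η : R →ₗ[R] X 0)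
    (d : ∀ i, X i →ₗ[R] X (i + 1)) :
    ∀ i, coresolutionObj X i →ₗ[R] coresolutionObj X (i + 1)
  | 0 => 0
  | 1 => η
  | i + 2 => d i

theorem exact_coresolutionMap {X : ℕ → ModuleCat.{u} R} {η : R →ₗ[R] X 0}
    {d : ∀ i, X i →ₗ[R] X (i + 1)} (hη : Function.Injective η) (hηd : Function.Exact η (d 0))
    (hd : ∀ i, Function.Exact (d i) (d (i + 1))) :
    ∀ i, Function.Exact (coresolutionMap η d i) (coresolutionMap η d (i + 1))
  | 0 => fun x => ⟨fun hx => ⟨0, (hη (hx.trans (map_zero η).symm)).symm⟩, by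
      rintro ⟨y, rfl⟩
      exact map_zero η⟩
  | 1 => hηd
  | i + 2 => hd i

variable {X : ℕ → ModuleCat.{u} R} {η : R →ₗ[R] X 0} {d : ∀ i, X i →ₗ[R] X (i + 1)}

/-- The map R → A sending 1 to `a` extends along `η`, so U generates `A`. -/
theorem exists_mem_range_pi_of_homExactAt (hX : ∀ i, IsInAdd R U (X i)) {A : Type u}
    [AddCommGroup A] [Module R A]
    (hA : HomExactAt (coresolutionMap η d 0) (coresolutionMap η d 1) A) (a : A) :
    ∃ (k : ℕ) (f : (Fin k → U) →ₗ[R] A), a ∈ LinearMap.range f := by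
  obtain ⟨g, hg⟩ : ∃ g : X 0 →ₗ[R] A, g ∘ₗ η = LinearMap.toSpanSingleton R A a :=
    hA (LinearMap.toSpanSingleton R A a) (LinearMap.comp_zero _)
  obtain ⟨k, i, q, hq⟩ := hX 0
  refine ⟨k, g ∘ₗ q, i (η 1), ?_⟩
  have h1 : g (η 1) = a := (LinearMap.congr_fun hg (1 : R)).trans (one_smul R a)
  have h2 : q (i (η 1)) = η 1 := LinearMap.congr_fun hq _
  rw [LinearMap.comp_apply, h2]
  exact h1

/-- A module that behaves like an injective module with respect to the coresolution of `R`, and with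
vanishing first `U`-Tor groups, lies in `add-lim U`. -/
theorem isInAddLim_of_torVanishing_zero [Module.Finite R U] (hw : HasWeakCokernels R U)
    (hX : ∀ i, IsInAdd R U (X i))
    (hex : ∀ i, Function.Exact (coresolutionMap η d i) (coresolutionMap η d (i + 1)))
    (hU : ∀ i, HomExactAt (coresolutionMap η d i) (coresolutionMap η d (i + 1)) U)
    {A : Type u} [AddCommGroup A] [Module R A]
    (hA : ∀ i, HomExactAt (coresolutionMap η d i) (coresolutionMap η d (i + 1)) A)
    (hT : TorVanishing (R := R) U 0 A) : IsInAddLim R U A := by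
  refine ResolvesRelations.isInAddLim ?_ (exists_mem_range_pi_of_homExactAt hX (hA 0))
  intro k f x hx
  obtain ⟨t, ht⟩ : ∃ t : X 0 →ₗ[R] (Fin k → U), t ∘ₗ η = LinearMap.toSpanSingleton R _ x :=
    (hU 0).pi (Fin k) (LinearMap.toSpanSingleton R _ x) (LinearMap.comp_zero _)
  have htx : t (η 1) = x := (LinearMap.congr_fun ht (1 : R)).trans (one_smul R x)
  obtain ⟨g, hg⟩ : ∃ g : X 1 →ₗ[R] A, g ∘ₗ d 0 = f ∘ₗ t :=
    hA 1 (f ∘ₗ t) (by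
      change f ∘ₗ (t ∘ₗ η) = 0
      rw [ht]
      ext
      simp [hx])
  obtain ⟨k0, i0, p0, h0⟩ := hX 0
  obtain ⟨k1, i1, p1, h1⟩ := hX 1
  obtain ⟨l, a, b, G, ha, hb⟩ := exists_amalgam_pi f (g ∘ₗ p1)
  -- `G` kills `M`, and `M` sends the image of 1 to `a x` because `d 0` kills `η 1`. Factoring `G`
  -- through a weak cokernel of `M` therefore resolves the relation `x`.
  let M : (Fin k0 → U) →ₗ[R] (Fin l → U) := (a ∘ₗ t - b ∘ₗ i1 ∘ₗ d 0) ∘ₗ p0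
  have hM : G ∘ₗ M = 0 := by
    refine LinearMap.ext fun y => ?_
    have e1 := LinearMap.congr_fun ha (t (p0 y))
    have e2 := LinearMap.congr_fun hb (i1 (d 0 (p0 y)))
    have e3 := LinearMap.congr_fun h1 (d 0 (p0 y))
    have e4 := LinearMap.congr_fun hg (p0 y)
    simp only [LinearMap.comp_apply, LinearMap.id_apply] at e1 e2 e3 e4
    rw [e3, e4] at e2
    simp [M, e1, e2]
  obtain ⟨q, B, hB⟩ := hw M
  obtain ⟨G', hG'⟩ := hT M B trivial hB G hM
  refine ⟨q, B ∘ₗ a, G', by rw [← LinearMap.comp_assoc, hG', ha], ?_⟩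
  have e1 := LinearMap.congr_fun hB.comp_eq_zero (i0 (η 1))
  have e2 : p0 (i0 (η 1)) = η 1 := LinearMap.congr_fun h0 (η 1)
  have e3 : d 0 (η 1) = 0 := (hex 1 (η 1)).2 ⟨(1 : R), rfl⟩
  simpa [M, e2, e3, htx] using e1

/-- Resolve step by step by direct sums of copies of U. The kernel of each step again behaves like
an injective module on the coresolution of R, and its Tor vanishing starts one degree lower. -/
theorem hasAddLimResolution_of_torVanishing [IsNoetherianRing R] [Module.Finite R U]
    (hw : HasWeakCokernels R U) (hX : ∀ i, IsInAdd R U (X i))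
    (hex : ∀ i, Function.Exact (coresolutionMap η d i) (coresolutionMap η d (i + 1)))
    (hU : ∀ i, HomExactAt (coresolutionMap η d i) (coresolutionMap η d (i + 1)) U) {m : ℕ} :
    ∀ {A : Type u} [AddCommGroup A] [Module R A],
      (∀ i, HomExactAt (coresolutionMap η d i) (coresolutionMap η d (i + 1)) A) →
      TorVanishing (R := R) U m A → HasAddLimResolution R U A m := by
  induction m with
  | zero =>
    intro A _ _ hA hT
    exact hasAddLimResolution_zero (isInAddLim_of_torVanishing_zero hw hX hex hU hA hT)
  | succ m ih =>
    intro A _ _ hA hT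
    -- With one copy of U for every map U → A, all maps from U lift tautologically.
    let p : ((U →ₗ[R] A) →₀ U) →ₗ[R] A := Finsupp.lsum ℕ fun f => f
    have hV : IsInAddLim R U ((U →ₗ[R] A) →₀ U) := IsInAddLim.finsupp _
    have hl : ∀ f : U →ₗ[R] A, ∃ f' : U →ₗ[R] ((U →ₗ[R] A) →₀ U), p ∘ₗ f' = f := fun f =>
      ⟨Finsupp.lsingle f, by ext; simp [p]⟩
    have hp : Function.Surjective p := by
      intro a
      obtain ⟨k, f, y, rfl⟩ := exists_mem_range_pi_of_homExactAt hX (hA 0) a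
      obtain ⟨f', rfl⟩ := exists_lift_of_isInAdd hl (isInAdd_pi k) f
      exact ⟨f' y, rfl⟩
    have hfin : ∀ i, Module.Finite R (coresolutionObj X i) := by
      rintro (_ | _ | i)
      · exact inferInstanceAs (Module.Finite R PUnit.{u + 1})
      · exact inferInstanceAs (Module.Finite R R)
      · obtain ⟨k, j, q, hq⟩ := hX i
        exact Module.Finite.of_surjective q fun x => ⟨j x, LinearMap.congr_fun hq x⟩
    refine HasAddLimResolution.splice hV p hp (ih (fun i => ?_) (hw.torVanishing_ker p hV hl hT))
    have := hfin (i + 1)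
    refine ((hU i).of_isInAddLim hV).ker (hA (i + 1)) ?_ (exists_lift_of_isInAdd hl (hX _))
    ext x
    exact (hex (i + 1) _).2 ⟨x, rfl⟩

end Resolution

/-! ### Consequences of the long exact Ext sequences. -/

section ExtSequences

variable {C : Type*} [Category C] [Abelian C] [HasExt.{u} C] {S : ShortComplex C}

theorem CategoryTheory.ShortComplex.ShortExact.ext_contravariant_bijective (hS : S.ShortExact)
    (Y : C) (j : ℕ) (h : Subsingleton (Ext.{u} S.X₂ Y j))
    (h' : Subsingleton (Ext.{u} S.X₂ Y (j + 1))) :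
    Function.Bijective (hS.extClass.precomp Y (add_comm 1 j)) := by
  constructor
  · rw [injective_iff_map_eq_zero]
    intro x hx
    obtain ⟨y, rfl⟩ := Ext.contravariant_sequence_exact₁ hS Y x (add_comm 1 j) hx
    rw [Subsingleton.elim y 0, Ext.comp_zero]
  · intro x
    exact Ext.contravariant_sequence_exact₃ hS Y x (Subsingleton.elim _ _) (add_comm 1 j)

theorem CategoryTheory.ShortComplex.ShortExact.exists_extension (hS : S.ShortExact) {Y : C}
    (h : Subsingleton (Ext.{u} S.X₃ Y 1)) (f : S.X₁ ⟶ Y) : ∃ g : S.X₂ ⟶ Y, S.f ≫ g = f := by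
  obtain ⟨y, hy⟩ := Ext.contravariant_sequence_exact₁ hS Y (Ext.mk₀ f) (add_zero 1)
    (Subsingleton.elim _ _)
  obtain ⟨g, rfl⟩ := Ext.homEquiv₀.symm.surjective y
  refine ⟨g, Ext.homEquiv₀.symm.injective ?_⟩
  simpa using hy

theorem CategoryTheory.ShortComplex.ShortExact.exists_lift (hS : S.ShortExact) {X : C}
    (h : Subsingleton (Ext.{u} X S.X₁ 1)) (f : X ⟶ S.X₃) : ∃ g : X ⟶ S.X₂, g ≫ S.g = f := by
  obtain ⟨y, hy⟩ := Ext.covariant_sequence_exact₃ X hS (Ext.mk₀ f) (zero_add 1)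
    (Subsingleton.elim _ _)
  obtain ⟨g, rfl⟩ := Ext.homEquiv₀.symm.surjective y
  refine ⟨g, Ext.homEquiv₀.symm.injective ?_⟩
  simpa using hy

theorem CategoryTheory.ShortComplex.ShortExact.subsingleton_ext_one_of_lift (hS : S.ShortExact)
    {X : C} (h₂ : Subsingleton (Ext.{u} X S.X₂ 1))
    (h : ∀ f : X ⟶ S.X₃, ∃ g : X ⟶ S.X₂, g ≫ S.g = f) : Subsingleton (Ext.{u} X S.X₁ 1) := by
  refine subsingleton_of_forall_eq 0 fun x => ?_
  obtain ⟨y, rfl⟩ := Ext.covariant_sequence_exact₁ X hS x (Subsingleton.elim _ _) (zero_add 1)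
  obtain ⟨f, rfl⟩ := Ext.homEquiv₀.symm.surjective y
  obtain ⟨g, rfl⟩ := h f
  rw [Ext.homEquiv₀_symm_apply, ← Ext.mk₀_comp_mk₀, Ext.comp_assoc_of_second_deg_zero,
    hS.comp_extClass, Ext.comp_zero]

theorem CategoryTheory.ShortComplex.ShortExact.subsingleton_ext_covariant_iff (hS : S.ShortExact)
    (X : C) (j : ℕ) (h : Subsingleton (Ext.{u} X S.X₂ j))
    (h' : Subsingleton (Ext.{u} X S.X₂ (j + 1))) :
    Subsingleton (Ext.{u} X S.X₃ j) ↔ Subsingleton (Ext.{u} X S.X₁ (j + 1)) := by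
  constructor
  · intro _
    refine subsingleton_of_forall_eq 0 fun x => ?_
    obtain ⟨y, rfl⟩ := Ext.covariant_sequence_exact₁ X hS x (Subsingleton.elim _ _) rfl
    rw [Subsingleton.elim y 0, Ext.zero_comp]
  · intro _
    refine subsingleton_of_forall_eq 0 fun x => ?_
    obtain ⟨y, rfl⟩ := Ext.covariant_sequence_exact₃ X hS x rfl (Subsingleton.elim _ _)
    rw [Subsingleton.elim y 0, Ext.zero_comp]

end ExtSequences

/-! ### Ext of modules and duals of projective resolutions. -/

section ModuleExt

variable {R : Type u} [Ring R] {X Y Z W U : Type u} [AddCommGroup X] [AddCommGroup Y]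
  [AddCommGroup Z] [AddCommGroup W] [AddCommGroup U] [Module R X] [Module R Y] [Module R Z]
  [Module R W] [Module R U]

theorem subsingleton_ext_zero_iff :
    Subsingleton (Ext.{u} (ModuleCat.of R X) (ModuleCat.of R Y) 0) ↔ ∀ f : X →ₗ[R] Y, f = 0 := by
  rw [Ext.homEquiv₀.subsingleton_congr, ModuleCat.homEquiv.subsingleton_congr]
  exact ⟨fun _ f => Subsingleton.elim _ _, fun h => subsingleton_of_forall_eq 0 h⟩

theorem subsingleton_ext_of_projective (P : Type u) [AddCommGroup P] [Module R P]
    [Module.Projective R P] (M : ModuleCat.{u} R) (j : ℕ) :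
    Subsingleton (Ext.{u} (ModuleCat.of R P) M (j + 1)) :=
  Ext.subsingleton_of_projective _ _ _

theorem subsingleton_ext_of_injective (E : Type u) [AddCommGroup E] [Module R E]
    [Module.Injective R E] (M : ModuleCat.{u} R) (j : ℕ) :
    Subsingleton (Ext.{u} M (ModuleCat.of R E) (j + 1)) :=
  have := Module.injective_object_of_injective_module R E
  Ext.subsingleton_of_injective _ _ _

theorem subsingleton_ext_congr_left (e : X ≃ₗ[R] Y) (M : ModuleCat.{u} R) (j : ℕ)
    (h : Subsingleton (Ext.{u} (ModuleCat.of R X) M j)) :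
    Subsingleton (Ext.{u} (ModuleCat.of R Y) M j) := by
  refine subsingleton_of_forall_eq 0 fun x => ?_
  rw [← Ext.mk₀_id_comp x, ← e.toModuleIso.inv_hom_id, ← Ext.mk₀_comp_mk₀_assoc,
    Subsingleton.elim ((Ext.mk₀ e.toModuleIso.hom).comp x (zero_add j)) 0, Ext.comp_zero]

theorem subsingleton_ext_congr_right (e : X ≃ₗ[R] Y) (M : ModuleCat.{u} R) (j : ℕ)
    (h : Subsingleton (Ext.{u} M (ModuleCat.of R X) j)) :
    Subsingleton (Ext.{u} M (ModuleCat.of R Y) j) := by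
  refine subsingleton_of_forall_eq 0 fun x => ?_
  rw [← Ext.comp_mk₀_id x, ← e.toModuleIso.inv_hom_id, ← Ext.mk₀_comp_mk₀,
    ← Ext.comp_assoc_of_third_deg_zero,
    Subsingleton.elim (x.comp (Ext.mk₀ e.toModuleIso.inv) (add_zero j)) 0, Ext.zero_comp]

/-- Dimension shifting along a surjection from a projective module onto `W`. -/
theorem subsingleton_ext_ker [Module.Projective R Z] {c : Z →ₗ[R] W} (hc : Function.Surjective c)
    (M : ModuleCat.{u} R) (j : ℕ) (h : Subsingleton (Ext.{u} (ModuleCat.of R W) M (j + 2))) :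
    Subsingleton (Ext.{u} (ModuleCat.of R (LinearMap.ker c)) M (j + 1)) :=
  ((LinearMap.shortExact_shortComplexKer hc).ext_contravariant_bijective M (j + 1)
    (subsingleton_ext_of_projective Z M _) (subsingleton_ext_of_projective Z M _)).1.subsingleton

/-- A map killing `A` factors through the image of `B`, which is the kernel of `c`; Ext^1(W, U) is
the obstruction to extending it to `Z`. -/
theorem HomExactAt.of_subsingleton_ext_one {A : X →ₗ[R] Y} {B : Y →ₗ[R] Z} {c : Z →ₗ[R] W}
    (hAB : Function.Exact A B) (hBc : Function.Exact B c) (hc : Function.Surjective c)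
    (h : Subsingleton (Ext.{u} (ModuleCat.of R W) (ModuleCat.of R U) 1)) : HomExactAt A B U := by
  intro f hf
  let B' : Y →ₗ[R] LinearMap.ker c := LinearMap.codRestrict _ B fun y => (hBc _).2 ⟨y, rfl⟩
  have hB' : Function.Surjective B' := fun z => by
    obtain ⟨y, hy⟩ := (hBc z).1 z.2
    exact ⟨y, Subtype.ext hy⟩
  obtain ⟨g, hg⟩ := LinearMap.exists_comp_eq_of_ker_le hB' (f := f) (by
    intro y hy
    obtain ⟨x, rfl⟩ := (hAB y).1 (congrArg Subtype.val (LinearMap.mem_ker.1 hy))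
    exact LinearMap.congr_fun hf x)
  obtain ⟨g', hg'⟩ := (LinearMap.shortExact_shortComplexKer hc).exists_extension h
    (ModuleCat.ofHom g)
  refine ⟨g'.hom, ?_⟩
  rw [← hg]
  ext y
  exact LinearMap.congr_fun (congrArg ModuleCat.Hom.hom hg') (B' y)

/-- If `Ext^{j+1}(W, U) = 0`, then the dual of a projective resolution of `W` is exact at the
corresponding place. -/
theorem HomExactAt.of_subsingleton_ext {j : ℕ} :
    ∀ {W : Type u} [AddCommGroup W] [Module R W] {P : ℕ → ModuleCat.{u} R}
      {d : ∀ i, P (i + 1) →ₗ[R] P i} {ε : P 0 →ₗ[R] W}, (∀ i, Module.Projective R (P i)) →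
      Function.Surjective ε → Function.Exact (d 0) ε →
      (∀ i, Function.Exact (d (i + 1)) (d i)) →
      Subsingleton (Ext.{u} (ModuleCat.of R W) (ModuleCat.of R U) (j + 1)) →
      HomExactAt (d (j + 1)) (d j) U := by
  induction j with
  | zero =>
    intro W _ _ P d ε _ hε hdε hd h
    exact HomExactAt.of_subsingleton_ext_one (hd 0) hdε hε h
  | succ j ih =>
    intro W _ _ P d ε hP hε hdε hd h
    have := hP 0
    refine @ih (LinearMap.ker ε) _ _ (fun i => P (i + 1)) (fun i => d (i + 1))
      (LinearMap.codRestrict _ (d 0) fun x => (hdε _).2 ⟨x, rfl⟩) (fun i => hP _) ?_ ?_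
      (fun i => hd _) (subsingleton_ext_ker hε _ j h)
    · intro z
      obtain ⟨y, hy⟩ := (hdε z).1 z.2
      exact ⟨y, Subtype.ext hy⟩
    · intro x
      refine Iff.trans ?_ (hd 0 x)
      exact (Submodule.coe_eq_zero (p := LinearMap.ker ε)).symm

end ModuleExt

/-! ### Maps into the terms of a minimal injective resolution. -/

section MinimalInjective

variable {R : Type u} [Ring R] {U : Type u} [AddCommGroup U] [Module R U]
  (I : MinimalInjectiveResolution R U)

namespace MinimalInjectiveResolution

theorem comp_eq_zero (i : ℕ) : I.α (i + 1) ∘ₗ I.α i = 0 := by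
  ext x
  exact (I.exact_succ i _).2 ⟨x, rfl⟩

/-- The corestriction of `αᵢ` to the kernel of `αᵢ₊₁`. -/
def toKer (i : ℕ) : I.E i →ₗ[R] LinearMap.ker (I.α (i + 1)) :=
  LinearMap.codRestrict _ (I.α i) fun x => LinearMap.congr_fun (I.comp_eq_zero i) x

theorem toKer_surjective (i : ℕ) : Function.Surjective (I.toKer i) := fun z => by
  obtain ⟨y, hy⟩ := (I.exact_succ i z).1 z.2
  exact ⟨y, Subtype.ext hy⟩

theorem ker_toKer (i : ℕ) : LinearMap.ker (I.toKer i) = LinearMap.ker (I.α i) :=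
  LinearMap.ker_codRestrict _ _ _

/-- The module `U` is the kernel of `α₀`. -/
noncomputable def equivKer : U ≃ₗ[R] LinearMap.ker (I.α 0) :=
  LinearEquiv.ofBijective
    (LinearMap.codRestrict _ I.η fun x => (I.exact_zero _).2 ⟨x, rfl⟩)
    ⟨fun _ _ h => I.injective_η (congrArg Subtype.val h), fun z => by
      obtain ⟨y, hy⟩ := (I.exact_zero z).1 z.2
      exact ⟨y, Subtype.ext hy⟩⟩

theorem subsingleton_ext_iff_ker (M : ModuleCat.{u} R) (j : ℕ) :
    Subsingleton (Ext.{u} M (ModuleCat.of R U) j) ↔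
      Subsingleton (Ext.{u} M (ModuleCat.of R (LinearMap.ker (I.α 0))) j) :=
  ⟨subsingleton_ext_congr_right I.equivKer M j, subsingleton_ext_congr_right I.equivKer.symm M j⟩

theorem subsingleton_ext_ker_iff (M : ModuleCat.{u} R) (i j : ℕ) :
    Subsingleton (Ext.{u} M (ModuleCat.of R (LinearMap.ker (I.α i))) (j + 1)) ↔
      Subsingleton (Ext.{u} M (ModuleCat.of R (LinearMap.ker (I.α 0))) (j + 1 + i)) := by
  induction i generalizing j with
  | zero => rfl
  | succ i ih =>
    have := I.injective i
    have h := (LinearMap.shortExact_shortComplexKer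
      (I.toKer_surjective i)).subsingleton_ext_covariant_iff M (j + 1)
        (subsingleton_ext_of_injective _ M _) (subsingleton_ext_of_injective _ M _)
    refine h.trans ?_
    change Subsingleton (Ext M (ModuleCat.of R (LinearMap.ker (I.toKer i))) (j + 1 + 1)) ↔ _
    rw [I.ker_toKer, ih (j + 1), show j + 1 + 1 + i = j + 1 + (i + 1) by omega]

/-- By dimension shifting, Ext^{i+1}(M, U) is Ext^1(M, ker α_i), the cokernel of Hom(M, E_i) →
Hom(M, ker α_{i+1}). -/
theorem subsingleton_ext_succ_iff (M : Type u) [AddCommGroup M] [Module R M] (i : ℕ) :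
    Subsingleton (Ext.{u} (ModuleCat.of R M) (ModuleCat.of R U) (i + 1)) ↔
      ∀ f : M →ₗ[R] LinearMap.ker (I.α (i + 1)), ∃ g : M →ₗ[R] I.E i, I.toKer i ∘ₗ g = f := by
  have e := I.subsingleton_ext_ker_iff (ModuleCat.of R M) i 0
  rw [show 0 + 1 + i = i + 1 by omega] at e
  rw [I.subsingleton_ext_iff_ker, ← e, ← I.ker_toKer]
  have hS := LinearMap.shortExact_shortComplexKer (I.toKer_surjective i)
  have := I.injective i
  constructor
  · intro h f
    obtain ⟨g, hg⟩ := hS.exists_lift h (ModuleCat.ofHom f)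
    exact ⟨g.hom, congrArg ModuleCat.Hom.hom hg⟩
  · intro h
    refine hS.subsingleton_ext_one_of_lift (subsingleton_ext_of_injective _ _ 0) fun f => ?_
    obtain ⟨g, hg⟩ := h f.hom
    exact ⟨ModuleCat.ofHom g, ModuleCat.hom_ext hg⟩

/-- Maps from `X` to the first `n` terms of the minimal injective resolution of `U` vanish if and
only if `Ext^i(L, U) = 0` for all submodules `L` of `X` and all `i < n`. -/
theorem forall_hom_eq_zero_iff (X : Type u) [AddCommGroup X] [Module R X] (n : ℕ) :
    (∀ i < n, ∀ f : X →ₗ[R] I.E i, f = 0) ↔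
      ∀ L : Submodule R X, ∀ i < n,
        Subsingleton (Ext.{u} (ModuleCat.of R L) (ModuleCat.of R U) i) := by
  constructor
  · intro h L i hi
    have hL : ∀ i < n, ∀ f : L →ₗ[R] I.E i, f = 0 := by
      intro i hi f
      have := I.injective i
      obtain ⟨g, hg⟩ := Module.Injective.out (R := R) (Q := I.E i) L.subtype
        L.subtype_injective f
      ext x
      rw [← hg, h i hi g]
      rfl
    rcases i with _ | i
    · rw [subsingleton_ext_zero_iff]
      intro f
      ext x
      exact I.injective_η ((LinearMap.congr_fun (hL 0 hi (I.η ∘ₗ f)) x).trans (map_zero _).symm)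
    · rw [I.subsingleton_ext_succ_iff]
      intro f
      refine ⟨0, ?_⟩
      ext x
      simpa using (LinearMap.congr_fun (hL (i + 1) hi ((LinearMap.ker _).subtype ∘ₗ f)) x).symm
  · intro h
    suffices key : ∀ i < n, ∀ (L : Submodule R X) (f : L →ₗ[R] I.E i), f = 0 by
      intro i hi f
      ext x
      exact LinearMap.congr_fun (key i hi ⊤ (f ∘ₗ (⊤ : Submodule R X).subtype)) ⟨x, trivial⟩
    -- a nonzero map to a term is nonzero on the preimage of an essential submodule
    have ess : ∀ (i : ℕ) (K : Submodule R (I.E i)),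
        (∀ N : Submodule R (I.E i), N ⊓ K = ⊥ → N = ⊥) →
        (∀ (L : Submodule R X) (f : L →ₗ[R] I.E i), LinearMap.range f ≤ K → f = 0) →
        ∀ (L : Submodule R X) (f : L →ₗ[R] I.E i), f = 0 := by
      intro i K hK h0 L f
      rw [← LinearMap.range_eq_bot]
      refine hK _ (eq_bot_iff.2 ?_)
      rintro _ ⟨⟨x, rfl⟩, hxK⟩
      -- The preimage of `K` is pushed forward to a submodule of `X`, since the induction quantifies
      -- over submodules of `X`.
      have hle : (K.comap f).map L.subtype ≤ L := Submodule.map_subtype_le _ _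
      have := h0 ((K.comap f).map L.subtype) (f ∘ₗ Submodule.inclusion hle) (by
        rintro _ ⟨⟨_, y, hy, rfl⟩, rfl⟩
        exact hy)
      exact LinearMap.congr_fun this ⟨x, x, hxK, rfl⟩
    intro i
    induction i with
    | zero =>
      intro hi
      refine ess 0 _ I.essential_zero fun L f hf => ?_
      have h0 := subsingleton_ext_zero_iff.1 (h L 0 hi)
      have hk : ∀ x, f x ∈ LinearMap.ker (I.α 0) := fun x => by
        obtain ⟨y, hy⟩ := hf ⟨x, rfl⟩
        exact (I.exact_zero _).2 ⟨y, hy⟩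
      have := h0 (I.equivKer.symm.toLinearMap ∘ₗ LinearMap.codRestrict _ f hk)
      ext x
      have hx := LinearMap.congr_fun this x
      simp only [LinearMap.comp_apply, LinearEquiv.coe_coe, LinearMap.zero_apply,
        LinearEquiv.map_eq_zero_iff] at hx
      exact congrArg Subtype.val hx
    | succ i ih =>
      intro hi
      refine ess (i + 1) _ (I.essential_succ i) fun L f hf => ?_
      have hk : ∀ x, f x ∈ LinearMap.ker (I.α (i + 1)) := fun x => by
        obtain ⟨y, hy⟩ := hf ⟨x, rfl⟩
        exact (I.exact_succ i _).2 ⟨y, hy⟩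
      -- Ext vanishing lifts the map to E_i, where it is zero by induction.
      obtain ⟨g, hg⟩ := (I.subsingleton_ext_succ_iff L i).1 (h L (i + 1) hi)
        (LinearMap.codRestrict _ f hk)
      rw [ih (by omega) L g, LinearMap.comp_zero] at hg
      ext x
      exact (congrArg Subtype.val (LinearMap.congr_fun hg x)).symm

end MinimalInjectiveResolution

end MinimalInjective

/-! ### Modules whose U-dual computes Ext over S. -/

section Dual

variable {R : Type u} [Ring R] (S : Type u) [Ring S] {U : Type u} [AddCommGroup U] [Module R U]
  [Module Sᵐᵒᵖ U] [SMulCommClass R Sᵐᵒᵖ U]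

/-- The map `Hom_R(P, U) → Hom_R(W, U)` of right `S`-modules induced by `q : W → P`. -/
def homDualMap {W P : Type*} [AddCommGroup W] [AddCommGroup P] [Module R W] [Module R P]
    (q : W →ₗ[R] P) : (P →ₗ[R] U) →ₗ[Sᵐᵒᵖ] (W →ₗ[R] U) where
  toFun g := g ∘ₗ q
  map_add' _ _ := LinearMap.add_comp _ _ _
  map_smul' _ _ := LinearMap.smul_comp _ _ _

variable (R U) in
/-- The finiteness, reflexivity and acyclicity conditions on a left `R`-module `W` under which its
`U`-dual can be used to compute `Ext_S(-, U)`. -/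
structure IsDualizable (W : Type u) [AddCommGroup W] [Module R W] : Prop where
  finite_dual : Module.Finite Sᵐᵒᵖ (W →ₗ[R] U)
  torsionless : ∀ w : W, (∀ g : W →ₗ[R] U, g w = 0) → w = 0
  reflexive : ∀ φ : (W →ₗ[R] U) →ₗ[Sᵐᵒᵖ] U, ∃ w : W, ∀ g, φ g = g w
  subsingleton_ext : ∀ j : ℕ, Subsingleton
    (Ext.{u} (ModuleCat.of Sᵐᵒᵖ (W →ₗ[R] U)) (ModuleCat.of Sᵐᵒᵖ U) (j + 1))

variable {S}

theorem IsDualizable.of_isInAdd {Y W : Type u} [AddCommGroup Y] [Module R Y] [AddCommGroup W]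
    [Module R W] (hY : IsDualizable R S U Y) (hW : IsInAdd R Y W) : IsDualizable R S U W := by
  obtain ⟨k, i, p, hpi⟩ := hW
  let a : Fin k → (W →ₗ[R] U) →ₗ[Sᵐᵒᵖ] (Y →ₗ[R] U) := fun j =>
    homDualMap S (p ∘ₗ LinearMap.single R (fun _ => Y) j)
  let b : Fin k → (Y →ₗ[R] U) →ₗ[Sᵐᵒᵖ] (W →ₗ[R] U) := fun j =>
    homDualMap S (LinearMap.proj j ∘ₗ i)
  have hsum : ∀ y : Fin k → Y, ∑ j, p (Pi.single j (y j)) = p y := fun y => by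
    rw [← map_sum, Finset.univ_sum_single]
  have hpi' : ∀ w, p (i w) = w := fun w => LinearMap.congr_fun hpi w
  have hab : ∀ g, ∑ j, b j (a j g) = g := fun g => by
    refine LinearMap.ext fun w => ?_
    have : (∑ j, b j (a j g)) w = ∑ j, g (p (Pi.single j (i w j))) := by
      rw [LinearMap.sum_apply]; rfl
    rw [this, ← map_sum, hsum, hpi']
  refine ⟨?_, fun w hw => ?_, fun φ => ?_, fun j => ?_⟩
  · have := hY.finite_dual
    refine Module.Finite.of_surjective (M := Fin k → (Y →ₗ[R] U))
      (∑ j, b j ∘ₗ LinearMap.proj j) fun g => ⟨fun j => a j g, ?_⟩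
    simpa using hab g
  · rw [← hpi' w, show i w = 0 from funext fun j => hY.torsionless _ fun g => hw (b j g), map_zero]
  · choose y hy using fun j => hY.reflexive (φ ∘ₗ b j)
    refine ⟨p y, fun g => ?_⟩
    conv_lhs => rw [← hab g]
    rw [map_sum, ← hsum, map_sum]
    exact Finset.sum_congr rfl fun j _ => hy j (a j g)
  · have hid : 𝟙 (ModuleCat.of Sᵐᵒᵖ (W →ₗ[R] U)) =
        ∑ j, ModuleCat.ofHom (a j) ≫ ModuleCat.ofHom (b j) := by
      refine ModuleCat.hom_ext (LinearMap.ext fun g => ?_)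
      simpa [ModuleCat.hom_sum] using (hab g).symm
    refine subsingleton_of_forall_eq 0 fun e => ?_
    have := hY.subsingleton_ext j
    rw [← Ext.mk₀_id_comp e, hid, Ext.mk₀_sum, Ext.sum_comp]
    refine Finset.sum_eq_zero fun t _ => ?_
    rw [← Ext.mk₀_comp_mk₀_assoc, Subsingleton.elim ((Ext.mk₀ _).comp e _) 0, Ext.comp_zero]

theorem IsEndomorphismRing.isDualizable_self (hS : IsEndomorphismRing R S U) :
    IsDualizable R S U U := by
  have hbij : Function.Bijective
      (LinearMap.toSpanSingleton Sᵐᵒᵖ (U →ₗ[R] U) LinearMap.id) := by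
    refine ⟨fun s t hst => hS.1 ?_, fun f => hS.exists_smul_id f⟩
    exact LinearMap.ext fun x => LinearMap.congr_fun hst x
  let e := LinearEquiv.ofBijective _ hbij
  have := Module.Projective.of_equiv e
  refine ⟨Module.Finite.of_surjective _ hbij.2, fun w hw => hw LinearMap.id,
    fun φ => ⟨φ LinearMap.id, fun g => ?_⟩, fun j => subsingleton_ext_of_projective _ _ j⟩
  obtain ⟨s, rfl⟩ := hS.exists_smul_id g
  simp

section ShortExact

variable {W X V : Type u} [AddCommGroup W] [AddCommGroup X] [AddCommGroup V] [Module R W]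
  [Module R X] [Module R V] {a : W →ₗ[R] X} {b : X →ₗ[R] V}

theorem shortExact_homDualMap (hb : Function.Surjective b) (hab : Function.Exact a b)
    (hext : ∀ g : W →ₗ[R] U, ∃ h : X →ₗ[R] U, h ∘ₗ a = g) :
    (ModuleCat.shortComplexOfCompEqZero (homDualMap S b : (V →ₗ[R] U) →ₗ[Sᵐᵒᵖ] _)
      (homDualMap S a) (by
        ext g x
        exact (congrArg g ((hab _).2 ⟨x, rfl⟩)).trans (map_zero g))).ShortExact := by
  refine ModuleCat.shortComplex_shortExact _ ?_ ?_ hext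
  · intro g
    constructor
    · intro hg
      obtain ⟨h, hh⟩ := LinearMap.exists_comp_eq_of_ker_le hb (f := g) (by
        intro x hx
        obtain ⟨y, rfl⟩ := (hab x).1 hx
        exact LinearMap.congr_fun hg y)
      exact ⟨h, hh⟩
    · rintro ⟨h, rfl⟩
      exact LinearMap.ext fun x => (congrArg h ((hab _).2 ⟨x, rfl⟩)).trans (map_zero h)
  · intro g h hgh
    exact (LinearMap.cancel_right hb).1 hgh

/-- Pulled back to the dual of `X`, `φ` is evaluation at some `x`. Every functional on `V` kills `b
x`, so torsionlessness of `V` puts `x` in the image of `W`. -/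
theorem reflexive_of_exact (hab : Function.Exact a b)
    (hext : ∀ g : W →ₗ[R] U, ∃ h : X →ₗ[R] U, h ∘ₗ a = g) (hX : IsDualizable R S U X)
    (hV : ∀ v : V, (∀ g : V →ₗ[R] U, g v = 0) → v = 0) (φ : (W →ₗ[R] U) →ₗ[Sᵐᵒᵖ] U) :
    ∃ w : W, ∀ g, φ g = g w := by
  obtain ⟨x, hx⟩ := hX.reflexive (φ ∘ₗ homDualMap S a)
  have hbx : b x = 0 := hV _ fun g => by
    refine (hx (g ∘ₗ b)).symm.trans ?_
    have : homDualMap S a (g ∘ₗ b) = 0 :=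
      LinearMap.ext fun y => (congrArg g ((hab _).2 ⟨y, rfl⟩)).trans (map_zero g)
    rw [LinearMap.comp_apply, this, map_zero]
  obtain ⟨w, rfl⟩ := (hab x).1 hbx
  refine ⟨w, fun g => ?_⟩
  obtain ⟨h, rfl⟩ := hext g
  exact hx h

/-- Ext^1 of the dual of `W` consists of the functionals on the dual of `V` modulo those extending
to the dual of `X`. Each is evaluation at some b x, and evaluation at x extends it. -/
theorem subsingleton_ext_one_dual (hb : Function.Surjective b) (hab : Function.Exact a b)
    (hext : ∀ g : W →ₗ[R] U, ∃ h : X →ₗ[R] U, h ∘ₗ a = g) (hX : IsDualizable R S U X)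
    (hV : ∀ φ : (V →ₗ[R] U) →ₗ[Sᵐᵒᵖ] U, ∃ v : V, ∀ g, φ g = g v) :
    Subsingleton (Ext.{u} (ModuleCat.of Sᵐᵒᵖ (W →ₗ[R] U)) (ModuleCat.of Sᵐᵒᵖ U) 1) := by
  refine subsingleton_of_forall_eq 0 fun e => ?_
  have hE := shortExact_homDualMap (S := S) hb hab hext
  have := hX.subsingleton_ext 0
  obtain ⟨y, rfl⟩ := Ext.contravariant_sequence_exact₃ hE (ModuleCat.of Sᵐᵒᵖ U) e
    (Subsingleton.elim _ _) (add_zero 1)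
  obtain ⟨φ, rfl⟩ := Ext.homEquiv₀.symm.surjective y
  obtain ⟨v, hv⟩ := hV φ.hom
  obtain ⟨x, rfl⟩ := hb v
  have hφ : φ = ModuleCat.ofHom (homDualMap S b) ≫
      ModuleCat.ofHom (LinearMap.applyₗ' Sᵐᵒᵖ x : (X →ₗ[R] U) →ₗ[Sᵐᵒᵖ] U) :=
    ModuleCat.hom_ext (LinearMap.ext fun g => hv g)
  rw [Ext.homEquiv₀_symm_apply, hφ, ← Ext.mk₀_comp_mk₀]
  exact hE.extClass_comp_assoc _

end ShortExact

/-- The left module `R` is dualizable when it has a `Hom(-, U)`-exact coresolution by modules in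
`add U`. -/
theorem isDualizable_of_coresolution (hS : IsEndomorphismRing R S U) {X : ℕ → ModuleCat.{u} R}
    {η : R →ₗ[R] X 0} {d : ∀ i, X i →ₗ[R] X (i + 1)} (hX : ∀ i, IsInAdd R U (X i))
    (hex : ∀ i, Function.Exact (coresolutionMap η d i) (coresolutionMap η d (i + 1)))
    (hU : ∀ i, HomExactAt (coresolutionMap η d i) (coresolutionMap η d (i + 1)) U) :
    IsDualizable R S U R := by
  have hXd : ∀ i, IsDualizable R S U (X i) := fun i => hS.isDualizable_self.of_isInAdd (hX i)
  -- The cosyzygies of the coresolution, with `C 0` the copy of R. Torsionlessness of `C (i + 1)`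
  -- makes `C i` reflexive; reflexivity of `C (i + 1)` kills Ext^1 for `C i`, and higher Ext groups
  -- shift along the sequence.
  let C : (i : ℕ) → Submodule R (X i) := fun i => LinearMap.range (coresolutionMap η d (i + 1))
  have htl : ∀ i, ∀ w : C i, (∀ g : C i →ₗ[R] U, g w = 0) → w = 0 := fun i w hw =>
    Subtype.ext ((hXd i).torsionless _ fun g => hw (g ∘ₗ (C i).subtype))
  have hext : ∀ i, ∀ g : C i →ₗ[R] U, ∃ h : X i →ₗ[R] U, h ∘ₗ (C i).subtype = g := by
    intro i g
    obtain ⟨h, hh⟩ := hU i (g ∘ₗ (coresolutionMap η d (i + 1)).rangeRestrict) (by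
      refine LinearMap.ext fun x => ?_
      have : (coresolutionMap η d (i + 1)).rangeRestrict (coresolutionMap η d i x) = 0 :=
        Subtype.ext ((hex i _).2 ⟨x, rfl⟩)
      exact (congrArg g this).trans (map_zero g))
    refine ⟨h, LinearMap.ext ?_⟩
    rintro ⟨_, x, rfl⟩
    exact LinearMap.congr_fun hh x
  let b : ∀ i, X i →ₗ[R] C (i + 1) := fun i => (d i).rangeRestrict
  have hb : ∀ i, Function.Surjective (b i) := fun i => (d i).surjective_rangeRestrict
  have hab : ∀ i, Function.Exact (C i).subtype (b i) := by
    intro i x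
    have : b i x = 0 ↔ d i x = 0 := Subtype.ext_iff
    rw [this]
    refine (hex (i + 1) x).trans ?_
    constructor
    · rintro ⟨y, rfl⟩
      exact ⟨⟨_, y, rfl⟩, rfl⟩
    · rintro ⟨⟨_, y, rfl⟩, rfl⟩
      exact ⟨y, rfl⟩
  have hrefl : ∀ i, ∀ φ : (C i →ₗ[R] U) →ₗ[Sᵐᵒᵖ] U, ∃ w : C i, ∀ g, φ g = g w := fun i =>
    reflexive_of_exact (hab i) (hext i) (hXd i) (htl (i + 1))
  have hEx : ∀ j i, Subsingleton
      (Ext.{u} (ModuleCat.of Sᵐᵒᵖ (C i →ₗ[R] U)) (ModuleCat.of Sᵐᵒᵖ U) (j + 1)) := by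
    intro j
    induction j with
    | zero =>
      intro i
      exact subsingleton_ext_one_dual (hb i) (hab i) (hext i) (hXd i) (hrefl (i + 1))
    | succ j ih =>
      intro i
      have := ih (i + 1)
      exact ((shortExact_homDualMap (hb i) (hab i) (hext i)).ext_contravariant_bijective
        (ModuleCat.of Sᵐᵒᵖ U) (j + 1) ((hXd i).subsingleton_ext j)
        ((hXd i).subsingleton_ext (j + 1))).2.subsingleton
  have hC : IsDualizable R S U (C 0) := by
    have := (hXd 0).finite_dual
    exact ⟨Module.Finite.of_surjective (homDualMap S (C 0).subtype) (hext 0), htl 0, hrefl 0,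
      fun j => hEx j 0⟩
  have hη : Function.Injective η := by
    rw [injective_iff_map_eq_zero]
    intro x hx
    obtain ⟨y, hy⟩ := (hex 0 x).1 hx
    exact hy.symm
  let e : R ≃ₗ[R] C 0 := LinearEquiv.ofInjective η hη
  refine hC.of_isInAdd ⟨1, LinearMap.pi fun _ => e.toLinearMap,
    e.symm.toLinearMap ∘ₗ LinearMap.proj 0, ?_⟩
  ext
  simp

end Dual

/-! ### Transposes and their extension groups. -/

section TransposeExt

variable {R : Type u} [Ring R] (S : Type u) [Ring S] (U : Type u) [AddCommGroup U] [Module R U]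
  [Module Sᵐᵒᵖ U] [SMulCommClass R Sᵐᵒᵖ U]

variable (R) in
/-- There is an `R`-linear isomorphism between `Ext^i_S(N, U)` and `Ext^j_S(N', U)`. -/
def HasExtEquiv (N N' : ModuleCat.{u} Sᵐᵒᵖ) (i j : ℕ) : Prop :=
  ∃ e : Ext.{u} N (ModuleCat.of Sᵐᵒᵖ U) i ≃+ Ext.{u} N' (ModuleCat.of Sᵐᵒᵖ U) j,
    ∀ (r : R) (x : Ext.{u} N (ModuleCat.of Sᵐᵒᵖ U) i),
      e (x.comp (Ext.mk₀ (leftMul S U r)) (add_zero i)) =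
        (e x).comp (Ext.mk₀ (leftMul S U r)) (add_zero j)

/-- The transpose of `q : W → P` with respect to `U`: the cokernel of the dual of `q`. -/
abbrev transposeObj {W P : Type u} [AddCommGroup W] [AddCommGroup P] [Module R W] [Module R P]
    (q : W →ₗ[R] P) : ModuleCat.{u} Sᵐᵒᵖ :=
  ModuleCat.of Sᵐᵒᵖ ((W →ₗ[R] U) ⧸ LinearMap.range (homDualMap S q : (P →ₗ[R] U) →ₗ[Sᵐᵒᵖ] _))

/-- The elements of `P` annihilated by all maps `P → U` that kill the range of `q`. -/
def dualClosure {W P : Type u} [AddCommGroup W] [AddCommGroup P] [Module R W] [Module R P]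
    (q : W →ₗ[R] P) : Submodule R P where
  carrier := {x | ∀ g : P →ₗ[R] U, g ∘ₗ q = 0 → g x = 0}
  add_mem' hx hy g hg := by rw [map_add, hx g hg, hy g hg, add_zero]
  zero_mem' g _ := map_zero g
  smul_mem' r x hx g hg := by rw [map_smul, hx g hg, smul_zero]

variable {S U}

theorem HasExtEquiv.trans {N N' N'' : ModuleCat.{u} Sᵐᵒᵖ} {i j k : ℕ}
    (h : HasExtEquiv R S U N N' i j) (h' : HasExtEquiv R S U N' N'' j k) :
    HasExtEquiv R S U N N'' i k := by
  obtain ⟨e, he⟩ := h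
  obtain ⟨e', he'⟩ := h'
  exact ⟨e.trans e', fun r x => by simp [he, he']⟩

theorem HasExtEquiv.symm {N N' : ModuleCat.{u} Sᵐᵒᵖ} {i j : ℕ}
    (h : HasExtEquiv R S U N N' i j) : HasExtEquiv R S U N' N j i := by
  obtain ⟨e, he⟩ := h
  refine ⟨e.symm, fun r x => e.injective ?_⟩
  rw [he, AddEquiv.apply_symm_apply, AddEquiv.apply_symm_apply]

theorem HasExtEquiv.refl (N : ModuleCat.{u} Sᵐᵒᵖ) (i : ℕ) : HasExtEquiv R S U N N i i :=
  ⟨AddEquiv.refl _, fun _ _ => rfl⟩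

theorem HasExtEquiv.of_iso {N N' : ModuleCat.{u} Sᵐᵒᵖ} (e : N ≅ N') (i : ℕ) :
    HasExtEquiv R S U N N' i i := by
  refine ⟨AddEquiv.ofBijective ((Ext.mk₀ e.inv).precomp (ModuleCat.of Sᵐᵒᵖ U) (zero_add i))
    ⟨Function.LeftInverse.injective
      (g := (Ext.mk₀ e.hom).precomp (ModuleCat.of Sᵐᵒᵖ U) (zero_add i)) fun x => ?_,
      Function.RightInverse.surjective
      (g := (Ext.mk₀ e.hom).precomp (ModuleCat.of Sᵐᵒᵖ U) (zero_add i)) fun x => ?_⟩,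
    fun r x => ?_⟩
  · change (Ext.mk₀ e.hom).comp ((Ext.mk₀ e.inv).comp x (zero_add i)) (zero_add i) = x
    simp
  · change (Ext.mk₀ e.inv).comp ((Ext.mk₀ e.hom).comp x (zero_add i)) (zero_add i) = x
    simp
  · change (Ext.mk₀ e.inv).comp (x.comp _ (add_zero i)) (zero_add i) =
      ((Ext.mk₀ e.inv).comp x (zero_add i)).comp _ (add_zero i)
    rw [Ext.comp_assoc_of_third_deg_zero]

theorem CategoryTheory.ShortComplex.ShortExact.hasExtEquiv {T : ShortComplex (ModuleCat.{u} Sᵐᵒᵖ)}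
    (hT : T.ShortExact) (j : ℕ) (h : Subsingleton (Ext.{u} T.X₂ (ModuleCat.of Sᵐᵒᵖ U) j))
    (h' : Subsingleton (Ext.{u} T.X₂ (ModuleCat.of Sᵐᵒᵖ U) (j + 1))) :
    HasExtEquiv R S U T.X₁ T.X₃ j (j + 1) := by
  refine ⟨AddEquiv.ofBijective _ (hT.ext_contravariant_bijective (ModuleCat.of Sᵐᵒᵖ U) j h h'),
    fun r x => ?_⟩
  change hT.extClass.comp (x.comp _ (add_zero j)) (add_comm 1 j) =
    (hT.extClass.comp x (add_comm 1 j)).comp _ (add_zero (j + 1))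
  rw [Ext.comp_assoc_of_third_deg_zero]

section

variable {W P P₀ : Type u} [AddCommGroup W] [AddCommGroup P] [AddCommGroup P₀] [Module R W]
  [Module R P] [Module R P₀]

/-- Passing to the transpose of the next map of a `Hom(-, U)`-exact sequence is a syzygy. -/
theorem hasExtEquiv_transposeObj (hW : IsDualizable R S U W) {q : W →ₗ[R] P} {q₀ : P →ₗ[R] P₀}
    (hq : q₀ ∘ₗ q = 0) (h : HomExactAt q q₀ U) (j : ℕ) :
    HasExtEquiv R S U (transposeObj S U q₀) (transposeObj S U q) (j + 1) (j + 2) := by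
  let Q : (P →ₗ[R] U) →ₗ[Sᵐᵒᵖ] (W →ₗ[R] U) := homDualMap S q
  let N := LinearMap.range (homDualMap S q₀ : (P₀ →ₗ[R] U) →ₗ[Sᵐᵒᵖ] (P →ₗ[R] U))
  -- Thus the transpose of `q₀` embeds in the dual of `W` with quotient the transpose of `q`.
  have hN : N = LinearMap.ker Q := by
    ext g
    constructor
    · rintro ⟨g', rfl⟩
      change (g' ∘ₗ q₀) ∘ₗ q = 0
      rw [LinearMap.comp_assoc, hq, LinearMap.comp_zero]
    · exact fun hg => h g hg
  let f := N.liftQ Q hN.le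
  have hr : LinearMap.range f = LinearMap.range Q := Submodule.range_liftQ _ _ _
  have hex : Function.Exact f (LinearMap.range Q).mkQ := by
    rw [LinearMap.exact_iff, Submodule.ker_mkQ, hr]
  have hE : (ModuleCat.shortComplexOfCompEqZero f (LinearMap.range Q).mkQ
      hex.linearMap_comp_eq_zero).ShortExact := by
    refine ModuleCat.shortComplex_shortExact _ hex ?_ (Submodule.mkQ_surjective _)
    refine LinearMap.ker_eq_bot.1 ?_
    exact Submodule.ker_liftQ_eq_bot _ _ _ hN.ge
  exact hE.hasExtEquiv (j + 1) (hW.subsingleton_ext j) (hW.subsingleton_ext (j + 1))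

/-- The first extension group of a transpose. -/
theorem exists_dualClosure_to_ext (hW : IsDualizable R S U W) (hP : IsDualizable R S U P)
    (q : W →ₗ[R] P) :
    ∃ Φ : dualClosure U q →+
        Ext.{u} (transposeObj S U q) (ModuleCat.of Sᵐᵒᵖ U) 1,
      Function.Surjective Φ ∧ (∀ x, Φ x = 0 ↔ (x : P) ∈ LinearMap.range q) ∧
      ∀ (r : R) x, Φ (r • x) = (Φ x).comp (Ext.mk₀ (leftMul S U r)) (add_zero 1) := by
  let Q : (P →ₗ[R] U) →ₗ[Sᵐᵒᵖ] (W →ₗ[R] U) := homDualMap S q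
  have hex : Function.Exact (LinearMap.range Q).subtype (LinearMap.range Q).mkQ := by
    rw [LinearMap.exact_iff, Submodule.ker_mkQ, Submodule.range_subtype]
  have hE : (ModuleCat.shortComplexOfCompEqZero (LinearMap.range Q).subtype
      (LinearMap.range Q).mkQ hex.linearMap_comp_eq_zero).ShortExact :=
    ModuleCat.shortComplex_shortExact _ hex (Submodule.subtype_injective _)
      (Submodule.mkQ_surjective _)
  -- Maps from the range of `Q` to U are functionals on the dual of `P` that kill ker Q. By
  -- reflexivity of `P` these are the points of the closure, and those extending to the dual of `W`
  -- are the points of the range of `q`.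
  have hψ : ∀ x : dualClosure U q, ∃ ψ : LinearMap.range Q →ₗ[Sᵐᵒᵖ] U,
      ∀ g : P →ₗ[R] U, ψ (Q.rangeRestrict g) = g x := by
    intro x
    obtain ⟨ψ, hψ⟩ := LinearMap.exists_comp_eq_of_ker_le Q.surjective_rangeRestrict
      (f := (LinearMap.applyₗ' Sᵐᵒᵖ (x : P) : (P →ₗ[R] U) →ₗ[Sᵐᵒᵖ] U)) (by
        intro g hg
        rw [LinearMap.ker_rangeRestrict] at hg
        exact x.2 g hg)
    exact ⟨ψ, fun g => LinearMap.congr_fun hψ g⟩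
  choose ψ hψ using hψ
  have huniq : ∀ {x : dualClosure U q} {φ : LinearMap.range Q →ₗ[Sᵐᵒᵖ] U},
      (∀ g : P →ₗ[R] U, φ (Q.rangeRestrict g) = g x) → φ = ψ x := by
    intro x φ hφ
    refine LinearMap.ext fun z => ?_
    obtain ⟨g, rfl⟩ := Q.surjective_rangeRestrict z
    rw [hφ, hψ]
  let Φ : dualClosure U q →+ Ext.{u} (transposeObj S U q) (ModuleCat.of Sᵐᵒᵖ U) 1 :=
    { toFun := fun x => hE.extClass.comp (Ext.mk₀ (ModuleCat.ofHom (ψ x))) (add_zero 1)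
      map_zero' := by
        rw [← huniq (x := 0) (φ := 0) (fun g => by simp), ModuleCat.ofHom_zero, Ext.mk₀_zero,
          Ext.comp_zero]
      map_add' := fun x y => by
        rw [← huniq (x := x + y) (φ := ψ x + ψ y) (fun g => by simp [hψ]), ModuleCat.ofHom_add,
          Ext.mk₀_add, Ext.comp_add] }
  refine ⟨Φ, fun e => ?_, fun x => ⟨fun hx => ?_, fun hx => ?_⟩, fun r x => ?_⟩
  · have := hW.subsingleton_ext 0
    obtain ⟨y, rfl⟩ := Ext.contravariant_sequence_exact₃ hE (ModuleCat.of Sᵐᵒᵖ U) e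
      (Subsingleton.elim _ _) (add_zero 1)
    obtain ⟨φ, rfl⟩ := Ext.homEquiv₀.symm.surjective y
    obtain ⟨x, hx⟩ := hP.reflexive (φ.hom ∘ₗ Q.rangeRestrict)
    have hmem : x ∈ dualClosure U q := fun g hg => by
      rw [← hx g, LinearMap.comp_apply, show Q.rangeRestrict g = 0 from Subtype.ext hg, map_zero]
    refine ⟨⟨x, hmem⟩, ?_⟩
    change hE.extClass.comp (Ext.mk₀ (ModuleCat.ofHom (ψ ⟨x, hmem⟩))) (add_zero 1) = _
    rw [← huniq (x := ⟨x, hmem⟩) (φ := φ.hom) hx]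
    rfl
  · obtain ⟨y, hy⟩ := Ext.contravariant_sequence_exact₁ hE (ModuleCat.of Sᵐᵒᵖ U)
      (Ext.mk₀ (ModuleCat.ofHom (ψ x))) (add_zero 1) hx
    obtain ⟨φ, rfl⟩ := Ext.homEquiv₀.symm.surjective y
    rw [Ext.homEquiv₀_symm_apply, Ext.mk₀_comp_mk₀] at hy
    have hy' := (Ext.mk₀_bijective _ _).1 hy
    obtain ⟨w, hw⟩ := hW.reflexive φ.hom
    refine ⟨w, ?_⟩
    rw [← sub_eq_zero]
    refine hP.torsionless _ fun g => ?_
    have h1 : φ.hom (Q g) = ψ x (Q.rangeRestrict g) :=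
      LinearMap.congr_fun (congrArg ModuleCat.Hom.hom hy') (Q.rangeRestrict g)
    rw [hψ, hw] at h1
    rw [map_sub, sub_eq_zero]
    exact h1
  · obtain ⟨w, hw⟩ := hx
    change hE.extClass.comp (Ext.mk₀ (ModuleCat.ofHom (ψ x))) (add_zero 1) = 0
    rw [← huniq (x := x) (φ := (LinearMap.applyₗ' Sᵐᵒᵖ w : (W →ₗ[R] U) →ₗ[Sᵐᵒᵖ] U) ∘ₗ
      (LinearMap.range Q).subtype) (fun g => by rw [← hw]; rfl), ModuleCat.ofHom_comp,
      ← Ext.mk₀_comp_mk₀]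
    exact hE.extClass_comp_assoc _
  · change hE.extClass.comp (Ext.mk₀ (ModuleCat.ofHom (ψ (r • x)))) (add_zero 1) =
      (hE.extClass.comp (Ext.mk₀ (ModuleCat.ofHom (ψ x))) (add_zero 1)).comp _ (add_zero 1)
    rw [← huniq (x := r • x) (φ := (leftMul S U r).hom ∘ₗ ψ x) (fun g => ?_),
      Ext.comp_assoc_of_third_deg_zero, Ext.mk₀_comp_mk₀]
    · rfl
    · change r • ψ x (Q.rangeRestrict g) = g (r • (x : P))
      rw [hψ, map_smul]

/-- If `Ext^1` of the transpose of `q` is identified with `Ext^n_S(N, U)`, then the latter is the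
quotient of the closure of the range of `q` by the range of `q`. -/
theorem HasExtEquiv.exists_linearMap (hW : IsDualizable R S U W) (hP : IsDualizable R S U P)
    {q : W →ₗ[R] P} {N : ModuleCat.{u} Sᵐᵒᵖ} {n : ℕ}
    (h : HasExtEquiv R S U (transposeObj S U q) N 1 n) :
    letI := extModule R S U N n
    ∃ Ψ : dualClosure U q →ₗ[R] Ext.{u} N (ModuleCat.of Sᵐᵒᵖ U) n,
      Function.Surjective Ψ ∧ ∀ x, Ψ x = 0 ↔ (x : P) ∈ LinearMap.range q := by
  obtain ⟨Φ, hΦ, hker, hr⟩ := exists_dualClosure_to_ext (S := S) hW hP q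
  obtain ⟨e, he⟩ := h
  let _ := extModule R S U N n
  refine ⟨{ toFun := fun x => e (Φ x), map_add' := fun x y => by simp, map_smul' := fun r x => ?_ },
    e.surjective.comp hΦ, fun x => ?_⟩
  · rw [hr, he]
    rfl
  · exact (e.map_eq_zero_iff).trans (hker x)

end

end TransposeExt

/-! ### Realizing Ext over S by maps between powers of U or of R. -/

section ExtRealization

variable {R : Type u} [Ring R] {S : Type u} [Ring S] {U : Type u} [AddCommGroup U] [Module R U]
  [Module Sᵐᵒᵖ U] [SMulCommClass R Sᵐᵒᵖ U]

theorem finite_transposeObj {W P : Type u} [AddCommGroup W] [AddCommGroup P] [Module R W]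
    [Module R P] (hW : IsDualizable R S U W) (q : W →ₗ[R] P) :
    Module.Finite Sᵐᵒᵖ (transposeObj S U q) :=
  have := hW.finite_dual
  Module.Finite.of_surjective _ (Submodule.mkQ_surjective _)

theorem IsEndomorphismRing.isDualizable_pi (hS : IsEndomorphismRing R S U) (k : ℕ) :
    IsDualizable R S U (Fin k → U) :=
  hS.isDualizable_self.of_isInAdd (isInAdd_pi k)

/-- The transpose of the last map of a chain of weak cokernels is a higher syzygy. -/
theorem IsWeakCokernelChain.exists_hasExtEquiv (hS : IsEndomorphismRing R S U) {i : ℕ} :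
    ∀ {p k : ℕ} {A : (Fin p → U) →ₗ[R] (Fin k → U)}, IsWeakCokernelChain U i A →
      ∃ N : ModuleCat.{u} Sᵐᵒᵖ, Module.Finite Sᵐᵒᵖ N ∧
        ∀ j, HasExtEquiv R S U (transposeObj S U A) N (j + 1) (j + 1 + i) := by
  induction i with
  | zero =>
    intro p k A _
    exact ⟨_, finite_transposeObj (hS.isDualizable_pi p) A, fun j => HasExtEquiv.refl _ _⟩
  | succ i ih =>
    rintro p k B ⟨m, A, hA, hB⟩
    obtain ⟨N, hN, h⟩ := ih hA
    refine ⟨N, hN, fun j => ?_⟩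
    have := (hasExtEquiv_transposeObj (hS.isDualizable_pi m) hB.comp_eq_zero hB.homExactAt j).trans
      (h (j + 1))
    rwa [show j + 1 + 1 + i = j + 1 + (i + 1) by omega] at this

/-- Every finitely generated right `S`-module is the transpose of a map between powers of `U`. -/
theorem IsEndomorphismRing.exists_transposeObj_iso [IsNoetherianRing Sᵐᵒᵖ]
    (hS : IsEndomorphismRing R S U) (N : ModuleCat.{u} Sᵐᵒᵖ) [Module.Finite Sᵐᵒᵖ N] :
    ∃ (p k : ℕ) (A : (Fin p → U) →ₗ[R] (Fin k → U)), Nonempty (transposeObj S U A ≅ N) := by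
  obtain ⟨p, π, hπ⟩ := Module.Finite.exists_fin' Sᵐᵒᵖ N
  let θ : (Fin p → Sᵐᵒᵖ) →ₗ[Sᵐᵒᵖ] ((Fin p → U) →ₗ[R] U) := Fintype.linearCombination Sᵐᵒᵖ
    (fun i : Fin p => (LinearMap.proj i : (Fin p → U) →ₗ[R] U))
  have hθ : ∀ c u, θ c u = ∑ i, c i • u i := fun c u => by
    simp [θ, Fintype.linearCombination_apply]
  have hbij : Function.Bijective θ := by
    constructor
    · intro c c' h
      refine funext fun i => hS.1 (LinearMap.ext fun u => ?_)
      have := LinearMap.congr_fun h (Pi.single i u)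
      rw [hθ, hθ] at this
      simpa [Pi.single_apply, smul_ite] using this
    · intro g
      choose s hs using fun i => hS.exists_smul_id (g ∘ₗ LinearMap.single R (fun _ => U) i)
      refine ⟨s, LinearMap.pi_ext' fun i => LinearMap.ext fun u => ?_⟩
      rw [← hs i, LinearMap.comp_apply, hθ]
      simp [Pi.single_apply, smul_ite]
  let e := LinearEquiv.ofBijective θ hbij
  let π' : ((Fin p → U) →ₗ[R] U) →ₗ[Sᵐᵒᵖ] N := π ∘ₗ e.symm.toLinearMap
  have hπ' : Function.Surjective π' := hπ.comp e.symm.surjective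
  have := hS.finite_dual_pi p
  obtain ⟨k, B, hB⟩ := Submodule.fg_iff_exists_fin_generating_family.1
    ((inferInstance : IsNoetherian Sᵐᵒᵖ ((Fin p → U) →ₗ[R] U)).noetherian (LinearMap.ker π'))
  let A : (Fin p → U) →ₗ[R] (Fin k → U) := LinearMap.pi B
  have hr : LinearMap.range (homDualMap S A : ((Fin k → U) →ₗ[R] U) →ₗ[Sᵐᵒᵖ] _) =
      LinearMap.ker π' := by
    rw [← hB]
    ext g
    rw [Submodule.mem_span_range_iff_exists_fun]
    constructor
    · rintro ⟨f, rfl⟩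
      choose s hs using fun i => hS.exists_smul_id (f ∘ₗ LinearMap.single R (fun _ => U) i)
      refine ⟨s, LinearMap.ext fun u => ?_⟩
      change _ = f (A u)
      rw [← Finset.univ_sum_single (A u), map_sum, LinearMap.sum_apply]
      exact Finset.sum_congr rfl fun i _ => LinearMap.congr_fun (hs i) (B i u)
    · rintro ⟨c, rfl⟩
      refine ⟨∑ i, (c i • LinearMap.id : U →ₗ[R] U) ∘ₗ LinearMap.proj i, LinearMap.ext fun u => ?_⟩
      change (∑ i, (c i • LinearMap.id : U →ₗ[R] U) ∘ₗ LinearMap.proj i) (A u) = _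
      simp [A]
  exact ⟨p, k, A, ⟨((Submodule.quotEquivOfEq _ _ hr).trans
    (π'.quotKerEquivOfSurjective hπ')).toModuleIso⟩⟩

/-- Higher syzygies of finitely generated right `S`-modules are transposes of the last maps of
chains of weak cokernels. -/
theorem IsEndomorphismRing.exists_isWeakCokernelChain [IsNoetherianRing Sᵐᵒᵖ]
    (hS : IsEndomorphismRing R S U) (N : ModuleCat.{u} Sᵐᵒᵖ) [Module.Finite Sᵐᵒᵖ N] (i : ℕ) :
    ∃ (p k : ℕ) (A : (Fin p → U) →ₗ[R] (Fin k → U)), IsWeakCokernelChain U i A ∧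
      ∀ j, HasExtEquiv R S U (transposeObj S U A) N (j + 1) (j + 1 + i) := by
  induction i with
  | zero =>
    obtain ⟨p, k, A, ⟨e⟩⟩ := hS.exists_transposeObj_iso N
    exact ⟨p, k, A, trivial, fun j => HasExtEquiv.of_iso e _⟩
  | succ i ih =>
    obtain ⟨p, k, A, hA, h⟩ := ih
    obtain ⟨l, B, hB⟩ := hS.hasWeakCokernels A
    refine ⟨k, l, B, ⟨p, A, hA, hB⟩, fun j => ?_⟩
    have := (hasExtEquiv_transposeObj (hS.isDualizable_pi p) hB.comp_eq_zero hB.homExactAt j).trans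
      (h (j + 1))
    rwa [show j + 1 + 1 + i = j + 1 + (i + 1) by omega] at this

theorem finite_ext [IsNoetherianRing R] [Module.Finite R U] [IsNoetherianRing Sᵐᵒᵖ]
    (hS : IsEndomorphismRing R S U) (N : ModuleCat.{u} Sᵐᵒᵖ) [Module.Finite Sᵐᵒᵖ N] (n : ℕ) :
    letI := extModule R S U N (n + 1)
    Module.Finite R (Ext.{u} N (ModuleCat.of Sᵐᵒᵖ U) (n + 1)) := by
  obtain ⟨p, k, A, -, h⟩ := hS.exists_isWeakCokernelChain N n
  have h0 := h 0
  rw [show 0 + 1 + n = n + 1 by omega] at h0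
  obtain ⟨Ψ, hΨ, -⟩ := h0.exists_linearMap (hS.isDualizable_pi p) (hS.isDualizable_pi k)
  let _ := extModule R S U N (n + 1)
  exact Module.Finite.of_surjective Ψ hΨ

/-- The vanishing of `Tor_{n+1}^S(N, Hom_R(U, E)) = Hom_R(Ext^{n+1}_S(N, U), E)` for an injective
module `E`. -/
theorem torVanishing_iff_hom_ext_eq_zero [IsNoetherianRing Sᵐᵒᵖ] (hS : IsEndomorphismRing R S U)
    (E : Type u) [AddCommGroup E] [Module R E] [Module.Injective R E] (n : ℕ) :
    TorVanishing (R := R) U n E ↔ ∀ N : ModuleCat.{u} Sᵐᵒᵖ, Module.Finite Sᵐᵒᵖ N →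
      letI := extModule R S U N (n + 1)
      ∀ f : Ext.{u} N (ModuleCat.of Sᵐᵒᵖ U) (n + 1) →ₗ[R] E, f = 0 := by
  rw [torVanishing_iff_of_injective]
  constructor
  · intro h N _
    obtain ⟨p, k, A, hA, hN⟩ := hS.exists_isWeakCokernelChain N n
    have h0 := hN 0
    rw [show 0 + 1 + n = n + 1 by omega] at h0
    obtain ⟨Ψ, hΨ, hker⟩ := h0.exists_linearMap (hS.isDualizable_pi p) (hS.isDualizable_pi k)
    let _ := extModule R S U N (n + 1)
    intro f
    -- `F` kills the range of `A`, hence by hypothesis the kernel of the weak cokernel `B`, which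
    -- contains the closure of that range.
    obtain ⟨F, hF⟩ := Module.Injective.out (R := R) (Q := E) (dualClosure U A).subtype
      (Submodule.subtype_injective _) (f ∘ₗ Ψ)
    have hcl : ∀ x, A x ∈ dualClosure U A := fun x g hg => LinearMap.congr_fun hg x
    obtain ⟨l, B, hB⟩ := hS.hasWeakCokernels A
    have hle := h A B hA hB F (LinearMap.ext fun x => by
      have := hF ⟨A x, hcl x⟩
      rw [LinearMap.comp_apply, (hker _).2 ⟨x, rfl⟩, map_zero] at this
      exact this)
    rw [← LinearMap.cancel_right hΨ]
    refine LinearMap.ext fun x => ?_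
    rw [← hF x]
    refine hle (funext fun t => ?_)
    exact x.2 (LinearMap.proj t ∘ₗ B) (by
      rw [LinearMap.comp_assoc, hB.comp_eq_zero, LinearMap.comp_zero])
  · intro h p k l A B hA hB f hf x hx
    obtain ⟨N, hNf, hN⟩ := hA.exists_hasExtEquiv hS
    have h0 := hN 0
    rw [show 0 + 1 + n = n + 1 by omega] at h0
    obtain ⟨Ψ, hΨ, hker⟩ := h0.exists_linearMap (hS.isDualizable_pi p) (hS.isDualizable_pi k)
    let _ := extModule R S U N (n + 1)
    obtain ⟨g, hg⟩ := LinearMap.exists_comp_eq_of_ker_le hΨ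
      (f := f ∘ₗ (dualClosure U A).subtype) (by
        intro y hy
        obtain ⟨z, hz⟩ := (hker y).1 hy
        rw [LinearMap.mem_ker, LinearMap.comp_apply, Submodule.subtype_apply, ← hz]
        exact LinearMap.congr_fun hf z)
    have hxm : x ∈ dualClosure U A := fun φ hφ => by
      obtain ⟨φ', rfl⟩ := hB.homExactAt φ hφ
      rw [LinearMap.comp_apply, LinearMap.mem_ker.1 hx, map_zero]
    have := LinearMap.congr_fun hg ⟨x, hxm⟩
    rw [h N hNf g] at this
    exact this.symm

/-- If `Ext^{j+1}_R(W, U) = 0` for `j < i`, then the dual of a free presentation of `W` is part of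
the beginning of a projective resolution of a right `S`-module. -/
theorem exists_hasExtEquiv_of_subsingleton_ext [IsNoetherianRing R] (hR : IsDualizable R S U R)
    (i : ℕ) : ∀ {W : Type u} [AddCommGroup W] [Module R W] {a b : ℕ}
      (q : (Fin a → R) →ₗ[R] (Fin b → R)) (c : (Fin b → R) →ₗ[R] W),
      Function.Exact q c → Function.Surjective c →
      (∀ j < i, Subsingleton (Ext.{u} (ModuleCat.of R W) (ModuleCat.of R U) (j + 1))) →
      ∃ N : ModuleCat.{u} Sᵐᵒᵖ, Module.Finite Sᵐᵒᵖ N ∧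
        ∀ j, HasExtEquiv R S U (transposeObj S U q) N (j + 1) (j + 1 + i) := by
  induction i with
  | zero =>
    intro W _ _ a b q c _ _ _
    exact ⟨_, finite_transposeObj (hR.of_isInAdd (isInAdd_pi a)) q, fun j => HasExtEquiv.refl _ _⟩
  | succ i ih =>
    intro W _ _ a b q c hqc hc hW
    obtain ⟨a', π, hπ⟩ := Module.Finite.exists_fin' R (LinearMap.ker q)
    let q' : (Fin a' → R) →ₗ[R] (Fin a → R) := (LinearMap.ker q).subtype ∘ₗ π
    have hq'q : Function.Exact q' q := by
      rw [LinearMap.exact_iff, LinearMap.range_comp, LinearMap.range_eq_top.2 hπ,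
        Submodule.map_top, Submodule.range_subtype]
    let c' : (Fin a → R) →ₗ[R] LinearMap.ker c :=
      LinearMap.codRestrict _ q fun x => (hqc _).2 ⟨x, rfl⟩
    have hq'c' : Function.Exact q' c' := by
      intro x
      refine Iff.trans ?_ (hq'q x)
      exact (Submodule.coe_eq_zero (p := LinearMap.ker c)).symm
    have hc' : Function.Surjective c' := fun z => by
      obtain ⟨y, hy⟩ := (hqc z).1 z.2
      exact ⟨y, Subtype.ext hy⟩
    -- Passing to the syzygy uses up one vanishing Ext group; Ext^1(W, U) = 0 is what makes the dual
    -- sequence exact at this place.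
    obtain ⟨N, hN, h⟩ := ih q' c' hq'c' hc' fun j hj =>
      subsingleton_ext_ker hc _ j (hW (j + 1) (by omega))
    refine ⟨N, hN, fun j => ?_⟩
    have := (hasExtEquiv_transposeObj (hR.of_isInAdd (isInAdd_pi a'))
      hq'q.linearMap_comp_eq_zero
      (HomExactAt.of_subsingleton_ext_one hq'q hqc hc (hW 0 (by omega))) j).trans (h (j + 1))
    rwa [show j + 1 + 1 + i = j + 1 + (i + 1) by omega] at this

end ExtRealization

/-! ### Inclusions between the classes of modules. -/

section Classes

variable {R : Type u} [Ring R] {U : Type u} [AddCommGroup U] [Module R U]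

theorem subsingleton_ext_of_subsingleton (M : Type u) [AddCommGroup M] [Module R M]
    [Subsingleton M] (Y : ModuleCat.{u} R) (j : ℕ) :
    Subsingleton (Ext.{u} (ModuleCat.of R M) Y j) := by
  refine subsingleton_of_forall_eq 0 fun e => ?_
  rw [← Ext.mk₀_id_comp e, show 𝟙 (ModuleCat.of R M) = 0 from
    ModuleCat.hom_ext (LinearMap.ext fun x => Subsingleton.elim _ _), Ext.mk₀_zero, Ext.zero_comp]

theorem limDim_le_iff (A : Type u) [AddCommGroup A] [Module R A] (m : ℕ) :
    limDim R U A ≤ (m : ℕ∞) ↔ ∃ k ≤ m, HasAddLimResolution R U A k := by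
  constructor
  · intro h
    by_contra! hcon
    have : ((m + 1 : ℕ) : ℕ∞) ≤ limDim R U A := le_iInf₂ fun k hk => by
      have : m + 1 ≤ k := by
        by_contra hlt
        exact hcon k (by omega) hk
      exact_mod_cast this
    have h2 : ((m + 1 : ℕ) : ℕ∞) ≤ (m : ℕ∞) := this.trans h
    have h3 : m + 1 ≤ m := by exact_mod_cast h2
    omega
  · rintro ⟨k, hk, h⟩
    exact (iInf₂_le k h).trans (by exact_mod_cast hk)

theorem hBarClass_le_hClass (n : ℕ) : hBarClass R U n ≤ hClass R U n := by
  intro M hM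
  refine ⟨hM.1, fun i hi => ?_⟩
  by_cases h : (⊤ : Submodule R M) = ⊥
  · have : Subsingleton M := (Submodule.subsingleton_iff R).1 (subsingleton_of_bot_eq_top h.symm)
    exact subsingleton_ext_of_subsingleton M _ i
  · exact subsingleton_ext_congr_left Submodule.topEquiv _ i ((hM.2 ⊤ h).2 i hi)

theorem isSubmoduleClosed_hBarClass [IsNoetherianRing R] (n : ℕ) :
    IsSubmoduleClosed (hBarClass R U n) := by
  intro M hM L _
  have := hM.1
  refine ⟨inferInstanceAs (Module.Finite R L), fun L' hL' => ?_⟩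
  have e := L'.equivMapOfInjective L.subtype L.subtype_injective
  have h := hM.2 (L'.map L.subtype) fun h =>
    hL' (Submodule.map_injective_of_injective L.subtype_injective
      (h.trans (Submodule.map_bot _).symm))
  have := h.1
  exact ⟨Module.Finite.equiv e.symm,
    fun i hi => subsingleton_ext_congr_left e.symm _ i (h.2 i hi)⟩

theorem injective_directSum {n : ℕ} (E : Fin n → Type u) [∀ i, AddCommGroup (E i)]
    [∀ i, Module R (E i)] (hE : ∀ i, Module.Injective R (E i)) :
    Module.Injective R (⨁ i, E i) := by
  refine ⟨fun X Y _ _ _ _ f hf g => ?_⟩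
  choose h hh using fun i => (hE i).out f hf (DirectSum.component R (Fin n) E i ∘ₗ g)
  refine ⟨(DirectSum.linearEquivFunOnFintype R (Fin n) E).symm.toLinearMap ∘ₗ LinearMap.pi h,
    fun x => ?_⟩
  rw [LinearMap.comp_apply, LinearEquiv.coe_coe, LinearEquiv.symm_apply_eq]
  funext i
  exact hh i x

theorem forall_hom_directSum_eq_zero_iff {n : ℕ} (E : Fin n → Type u) [∀ i, AddCommGroup (E i)]
    [∀ i, Module R (E i)] (X : Type u) [AddCommGroup X] [Module R X] :
    (∀ f : X →ₗ[R] ⨁ i, E i, f = 0) ↔ ∀ i, ∀ f : X →ₗ[R] E i, f = 0 := by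
  constructor
  · intro h i f
    have := h (DirectSum.lof R (Fin n) E i ∘ₗ f)
    ext x
    have hx := congrArg (DirectSum.component R (Fin n) E i) (LinearMap.congr_fun this x)
    simpa [DirectSum.component.lof_self] using hx
  · intro h f
    refine LinearMap.ext fun x => DirectSum.ext_component R fun i => ?_
    exact LinearMap.congr_fun (h i (DirectSum.component R (Fin n) E i ∘ₗ f)) x

variable {S : Type u} [Ring S] [Module Sᵐᵒᵖ U] [SMulCommClass R Sᵐᵒᵖ U]

/-- Vanishing of Ext^1, ..., Ext^n makes the transpose of a free presentation `q` of M an n-th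
syzygy of some `N`, so Ext_S^{n+1}(N, U) is the closure of the range of `q` modulo that range. As
Hom(M, U) = 0, the closure is the whole free module and the quotient is M. -/
theorem hClass_le_eClass [IsNoetherianRing R] (hR : IsDualizable R S U R) (n : ℕ) :
    hClass R U (n + 1) ≤ eClass R S U (n + 1) := by
  intro M hM
  have := hM.1
  refine ⟨hM.1, ?_⟩
  obtain ⟨b, c, hc⟩ := Module.Finite.exists_fin' R M
  obtain ⟨a, π, hπ⟩ := Module.Finite.exists_fin' R (LinearMap.ker c)
  let q : (Fin a → R) →ₗ[R] (Fin b → R) := (LinearMap.ker c).subtype ∘ₗ π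
  have hqc : Function.Exact q c := by
    rw [LinearMap.exact_iff, LinearMap.range_comp, LinearMap.range_eq_top.2 hπ,
      Submodule.map_top, Submodule.range_subtype]
  obtain ⟨N, hN, h⟩ := exists_hasExtEquiv_of_subsingleton_ext (S := S) (U := U) hR n q c hqc hc
    fun j hj => hM.2 (j + 1) (by omega)
  have h0 := h 0
  rw [show 0 + 1 + n = n + 1 by omega] at h0
  obtain ⟨Ψ, hΨ, hker⟩ := h0.exists_linearMap (hR.of_isInAdd (isInAdd_pi a))
    (hR.of_isInAdd (isInAdd_pi b))
  refine ⟨N, hN, ?_⟩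
  let _ := extModule R S U N (n + 1)
  have hHom : ∀ f : M →ₗ[R] U, f = 0 := subsingleton_ext_zero_iff.1 (hM.2 0 (by omega))
  have hcl : ∀ x, x ∈ dualClosure U q := fun x g hg => by
    obtain ⟨f, rfl⟩ := LinearMap.exists_comp_eq_of_ker_le hc (f := g) (by
      intro y hy
      obtain ⟨z, rfl⟩ := (hqc y).1 hy
      exact LinearMap.congr_fun hg z)
    rw [hHom f, LinearMap.zero_comp, LinearMap.zero_apply]
  let Ψ' := Ψ ∘ₗ LinearMap.codRestrict _ LinearMap.id hcl
  have hΨ' : Function.Surjective Ψ' := fun y => by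
    obtain ⟨x, rfl⟩ := hΨ y
    exact ⟨x, rfl⟩
  have hker' : LinearMap.ker c = LinearMap.ker Ψ' := by
    ext x
    exact (hqc x).trans (hker ⟨x, hcl x⟩).symm
  obtain ⟨f, hf⟩ := LinearMap.exists_comp_eq_of_ker_le hc (f := Ψ') hker'.le
  refine ⟨LinearEquiv.ofBijective f ⟨?_, ?_⟩⟩
  · rw [injective_iff_map_eq_zero]
    intro y hy
    obtain ⟨x, rfl⟩ := hc y
    have : x ∈ LinearMap.ker Ψ' := by rw [LinearMap.mem_ker, ← hf]; exact hy
    rwa [← hker'] at this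
  · rw [← hf] at hΨ'
    exact Function.Surjective.of_comp hΨ'

end Classes

/-! ### Limit dimension over a generalized tilting module and the theorem. -/

section GeneralizedTilting

variable {R S : Type u} [Ring R] [Ring S]
  {U : Type u} [AddCommGroup U] [Module R U] [Module Sᵐᵒᵖ U] [SMulCommClass R Sᵐᵒᵖ U]

theorem IsGeneralizedTilting.finite (hU : IsGeneralizedTilting R U) : Module.Finite R U := by
  obtain ⟨P, d, ε, hP, hε, -, -⟩ := hU.gen
  have := (hP 0).1
  exact Module.Finite.of_surjective ε hε

theorem exists_coresolutionMap (hU : IsGeneralizedTilting R U) :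
    ∃ (X : ℕ → ModuleCat.{u} R) (η : R →ₗ[R] X 0) (d : ∀ i, X i →ₗ[R] X (i + 1)),
      (∀ i, IsInAdd R U (X i)) ∧
      (∀ i, Function.Exact (coresolutionMap η d i) (coresolutionMap η d (i + 1))) ∧
      ∀ i, HomExactAt (coresolutionMap η d i) (coresolutionMap η d (i + 1)) U := by
  obtain ⟨X, η, d, hX, hη, hηd, hd, h0, h1, h2⟩ := hU.coresolution
  refine ⟨X, η, d, hX, exact_coresolutionMap hη hηd hd, ?_⟩
  rintro (_ | _ | i) f hf
  · exact h0 f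
  · exact (h1 f).1 hf
  · exact (h2 i f).1 hf

/-- The `U`-limit dimension of an injective module is controlled by the vanishing of maps from
extension groups of right `S`-modules. -/
theorem IsGeneralizedTilting.limDim_le_iff [IsNoetherianRing R]
    [IsNoetherianRing Sᵐᵒᵖ] (hU : IsGeneralizedTilting R U)
    (hS : IsEndomorphismRing R S U) (E : Type u) [AddCommGroup E] [Module R E]
    [Module.Injective R E] (m : ℕ) :
    limDim R U E ≤ (m : ℕ∞) ↔ ∀ N : ModuleCat.{u} Sᵐᵒᵖ, Module.Finite Sᵐᵒᵖ N →
      letI := extModule R S U N (m + 1)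
      ∀ f : Ext.{u} N (ModuleCat.of Sᵐᵒᵖ U) (m + 1) →ₗ[R] E, f = 0 := by
  have := hU.finite
  rw [← torVanishing_iff_hom_ext_eq_zero hS, _root_.limDim_le_iff]
  constructor
  · rintro ⟨k, hk, h⟩
    obtain ⟨P, d, ε, hP, hε, hdε, hd⟩ := hU.gen
    exact (h.homExactAt_and_torVanishing (fun i => (hP i).1) (fun i => (hP i).2) hε hdε hd
      (fun i => HomExactAt.of_subsingleton_ext (fun i => (hP i).2) hε hdε hd
        (hU.selforthogonal (i + 1) (by omega)))).2 m hk
  · intro h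
    obtain ⟨X, η, d, hX, hex, hUX⟩ := exists_coresolutionMap hU
    exact ⟨m, le_rfl, hasAddLimResolution_of_torVanishing hS.hasWeakCokernels hX hex hUX
      (fun i => HomExactAt.of_injective (hex i) E) h⟩

theorem IsGeneralizedTilting.limDim_directSum_le_iff [IsNoetherianRing R]
    [IsNoetherianRing Sᵐᵒᵖ] (hU : IsGeneralizedTilting R U)
    (hS : IsEndomorphismRing R S U) (I : MinimalInjectiveResolution R U) (m : ℕ) :
    limDim R U (⨁ i : Fin (m + 1), I.E i) ≤ (m : ℕ∞) ↔
      ∀ M, eClass R S U (m + 1) M → ∀ L : Submodule R M, ∀ i < m + 1,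
        Subsingleton (Ext.{u} (ModuleCat.of R L) (ModuleCat.of R U) i) := by
  have := hU.finite
  have := injective_directSum (R := R) (fun i : Fin (m + 1) => I.E i) fun i => I.injective i
  rw [hU.limDim_le_iff hS]
  have key : ∀ N : ModuleCat.{u} Sᵐᵒᵖ,
      letI := extModule R S U N (m + 1)
      (∀ f : Ext.{u} N (ModuleCat.of Sᵐᵒᵖ U) (m + 1) →ₗ[R] ⨁ i : Fin (m + 1), I.E i, f = 0) ↔
        ∀ L : Submodule R (Ext.{u} N (ModuleCat.of Sᵐᵒᵖ U) (m + 1)), ∀ i < m + 1,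
          Subsingleton (Ext.{u} (ModuleCat.of R L) (ModuleCat.of R U) i) := by
    intro N
    let _ := extModule R S U N (m + 1)
    rw [forall_hom_directSum_eq_zero_iff, ← I.forall_hom_eq_zero_iff]
    exact ⟨fun h i hi => h ⟨i, hi⟩, fun h i => h i i.2⟩
  constructor
  · rintro h M ⟨_, N, hN, ⟨e⟩⟩ L i hi
    let _ := extModule R S U N (m + 1)
    exact subsingleton_ext_congr_left (L.equivMapOfInjective e.toLinearMap e.injective).symm _ i
      ((key N).1 (h N hN) (L.map e.toLinearMap) i hi)
  · intro h N hN
    let _ := extModule R S U N (m + 1)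
    refine (key N).2 (h (ModuleCat.of R (Ext.{u} N (ModuleCat.of Sᵐᵒᵖ U) (m + 1))) ⟨?_, N, hN, ?_⟩)
    · exact finite_ext hS N m
    · exact ⟨LinearEquiv.refl R _⟩

end GeneralizedTilting

theorem theorem3p7 (R S : Type u) [Ring R] [Ring S]
    [IsNoetherianRing R] [IsNoetherianRing Sᵐᵒᵖ]
    (U : Type u) [AddCommGroup U] [Module R U] [Module Sᵐᵒᵖ U] [SMulCommClass R Sᵐᵒᵖ U]
    (hU : IsGeneralizedTilting R U) (hS : IsEndomorphismRing R S U)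
    (I : MinimalInjectiveResolution R U)
    (n : ℕ) (hn : 1 ≤ n)
    (hid : HasInjectiveDimensionLE (ModuleCat.of R U) n)
    (htl : HasTorsionlessProperty S U (perpClass R U n)) :
    List.TFAE [
      limDim R U (⨁ i : Fin n, I.E i) ≤ ((n - 1 : ℕ) : ℕ∞),
      IsSubmoduleClosed (eClass R S U n) ∧ eClass R S U n = hClass R U n,
      IsSubmoduleClosed (eClass R S U n) ∧ eClass R S U n = hBarClass R U n] := by
  obtain ⟨m, rfl⟩ : ∃ m, n = m + 1 := ⟨n - 1, by omega⟩
  rw [Nat.add_sub_cancel, hU.limDim_directSum_le_iff hS I m]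
  obtain ⟨X, η, d, hX, hex, hUX⟩ := exists_coresolutionMap hU
  have hHE := hClass_le_eClass (isDualizable_of_coresolution hS hX hex hUX) m
  have hforward : (∀ M, eClass R S U (m + 1) M → ∀ L : Submodule R M, ∀ i < m + 1,
      Subsingleton (Ext.{u} (ModuleCat.of R L) (ModuleCat.of R U) i)) →
      eClass R S U (m + 1) ≤ hBarClass R U (m + 1) := by
    intro h M hM
    have := hM.1
    refine ⟨hM.1, fun L _ => ⟨inferInstanceAs (Module.Finite R L), fun i hi => ?_⟩⟩
    rcases lt_or_gt_of_ne hi with hlt | hgt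
    · exact h M hM L i hlt
    -- Injective dimension at most m + 1 is stored as dimension less than m + 2.
    · exact HasInjectiveDimensionLT.subsingleton (ModuleCat.of R U) (m + 1 + 1) i hgt _
  have hbackward : (∀ M, eClass R S U (m + 1) M → ∀ L : Submodule R M, L ≠ ⊥ →
      hClass R U (m + 1) (ModuleCat.of R L)) →
      ∀ M, eClass R S U (m + 1) M → ∀ L : Submodule R M, ∀ i < m + 1,
        Subsingleton (Ext.{u} (ModuleCat.of R L) (ModuleCat.of R U) i) := by
    intro h M hM L i hi
    -- Submodule-closure concerns nonzero submodules only; the zero module has no Ext.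
    by_cases hL : L = ⊥
    · subst hL
      exact subsingleton_ext_of_subsingleton _ _ i
    · exact (h M hM L hL).2 i hi.ne
  tfae_have 1 → 3 := fun h => by
    have heq : eClass R S U (m + 1) = hBarClass R U (m + 1) :=
      le_antisymm (hforward h) ((hBarClass_le_hClass (m + 1)).trans hHE)
    exact ⟨heq ▸ isSubmoduleClosed_hBarClass (m + 1), heq⟩
  tfae_have 3 → 1 := fun h => hbackward fun M hM L hL => by
    rw [h.2] at hM
    exact hM.2 L hL
  tfae_have 1 → 2 := fun h => by
    have heq : eClass R S U (m + 1) = hBarClass R U (m + 1) :=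
      le_antisymm (hforward h) ((hBarClass_le_hClass (m + 1)).trans hHE)
    exact ⟨heq ▸ isSubmoduleClosed_hBarClass (m + 1),
      le_antisymm ((hforward h).trans (hBarClass_le_hClass (m + 1))) hHE⟩
  tfae_have 2 → 1 := fun h => hbackward fun M hM L hL => h.2 ▸ h.1 M hM L hL
  tfae_finish
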